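/- Let $W:[0,1]^2\to[0,1]$ be a graphon, i.e. a symmetric measurable function. Let $X=(X_i)_{i\ge 1}$ be independent random variables, uniform on $[0,1]$, and let $G_\infty$ be a random graph on $\{1,2,\dots\}$ in which, given $X$, the pairs $\{i,j\}$, $i<j$, are edges independently of each other, with respective probabilities $W(X_i,X_j)$. The $W$-random graph $G_n$ is the subgraph of $G_\infty$ induced on $[n]=\{1,\dots,n\}$. For $1\le k\le n$ let $\mathcal S_{n,k}$ be the set of words $\alpha=\alpha_1\cdots\alpha_k$ over $[n]$ with distinct characters, and $A_n^k=|\mathcal S_{n,k}|=n!/(n-k)!$ (with $A_n^0=1$). Let $1\le k\le p$, $d\ge 1$, let $F=(F_1,\dots,F_d)$ be simple graphs with vertex set $[p]$, and let $\ell\in\mathcal S_{p,k}$. For $n\ge p$ and $\alpha\in\mathcal S_{n,k}$ put $$t_{\rm inj}(F_m^\ell,G_n^\alpha)=\frac{|\{f:[p]\to[n]\ \text{injective homomorphism } F_m\to G_n,\ f(\ell_i)=\alpha_i\ \text{for all } i\in[k]\}|}{A_{n-k}^{p-k}},$$ $t_{\rm inj}(F^\ell,G_n^\alpha)=(t_{\rm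 inj}(F_m^\ell,G_n^\alpha))_{m\in[d]}\in[0,1]^d$, and let $$\Gamma_n^{F,\ell}=\frac1{|\mathcal S_{n,k}|}\sum_{\alpha\in\mathcal S_{n,k}}\delta_{t_{\rm inj}(F^\ell,G_n^\alpha)},$$ a random probability measure on $[0,1]^d$. Assume that the labeled subgraph is the same for all $F_m$: for all $m,m'\in[d]$ and $i,i'\in\{\ell_1,\dots,\ell_k\}$, $\{i,i'\}\in E(F_m)$ if and only if $\{i,i'\}\in E(F_{m'})$. For $x\in[0,1]^k$ let $$\hat t_x=\prod_{i<j,\ \{\ell_i,\ell_j\}\in E(F_1)}W(x_i,x_j),\qquad \tilde t_x=\Big(\int \prod_{\{i,j\}\in E(F_m),\ \{i,j\}\not\subset\{\ell_1,\dots,\ell_k\}}W(y_i,y_j)\prod_{q\in[p]\setminus\{\ell_1,\dots,\ell_k\}}dy_q\Big)_{m\in[d]},$$ where $y_{\ell_i}=x_i$ for $i\in[k]$ and the other coordinates of $y$ are integrated over $[0,1]$. Let $\Gamma^{F,\ell}$ be the probability measure on $[0,1]^d$ such that, for every measurable $g\ge 0$, $$\Gamma^{F,\ell}(g)=\int_{[0,1]^k}\hat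 t_x\,g(\tilde t_x)\,dx+\Big(1-\int_{[0,1]^k}\hat t_x\,dx\Big)g(0).$$ **Theorem 3.1.** Almost surely, $\Gamma_n^{F,\ell}\to\Gamma^{F,\ell}$ as $n\to\infty$ for the weak topology on probability measures on $[0,1]^d$. Moreover (special case), let $D(x)=\int_0^1W(x,y)\,dy$, let $D_i^{(n)}=\frac1{n-1}|\{j:\{i,j\}\in E(G_n)\}|$ be the normalized degree of $i\in[n]$ in $G_n$, and let $\Pi_n(y)=\frac1n\sum_{i=1}^n\mathbf 1\{D_i^{(n)}\le D(y)\}$ for $y\in[0,1]$. If $D$ is (strictly) increasing on $[0,1]$, then almost surely $\sup_{y\in[0,1]}|\Pi_n(y)-y|\to0$ as $n\to\infty$. -/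

import Mathlib

open MeasureTheory ProbabilityTheory Filter Topology
open scoped unitInterval ENNReal

namespace GraphonLLN

/-- A graphon: a symmetric (Borel) measurable function `W : [0,1]² → [0,1]`. -/
structure Graphon where
  toFun : I → I → ℝ
  symm' : ∀ x y, toFun x y = toFun y x
  measurable' : Measurable (fun q : I × I => toFun q.1 q.2)
  nonneg' : ∀ x y, 0 ≤ toFun x y
  le_one' : ∀ x y, toFun x y ≤ 1

instance : CoeFun Graphon (fun _ => I → I → ℝ) := ⟨Graphon.toFun⟩

/-! ### `W`-random graphs -/

/-- `X` is an i.i.d. sequence of uniform random variables on `[0,1]` and `G` is a random graph on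
`ℕ` in which, given `X`, the pairs `{i, j}`, `i < j`, are edges independently of each other, with
respective probabilities `W (X i) (X j)`: the conditional probability given `σ(X)` that all the
pairs of a finite set `S` are edges is the product of the `W (X i) (X j)` over `S`.
The `W`-random graph `G_n` is the restriction of `G` to its first `n` vertices. -/
structure IsWRandomGraph (W : Graphon) {Ω : Type*} [MeasurableSpace Ω] (P : Measure Ω)
    (X : ℕ → Ω → I) (G : Ω → SimpleGraph ℕ) : Prop where
  measurable_X : ∀ i, Measurable (X i)
  iIndepFun_X : iIndepFun X P
  uniform_X : ∀ i, P.map (X i) = volume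
  measurableSet_adj : ∀ i j, MeasurableSet {ω | (G ω).Adj i j}
  condProb_edges : ∀ S : Finset (ℕ × ℕ), (∀ e ∈ S, e.1 < e.2) →
    P⟦{ω | ∀ e ∈ S, (G ω).Adj e.1 e.2} |
        MeasurableSpace.comap (fun ω i => X i ω) (inferInstance : MeasurableSpace (ℕ → I))⟧
      =ᵐ[P] fun ω => ∏ e ∈ S, W (X e.1 ω) (X e.2 ω)

/-- The subgraph induced on the first `n` vertices. -/
def restrictGraph (G : SimpleGraph ℕ) (n : ℕ) : SimpleGraph (Fin n) :=
  G.comap (fun i : Fin n => (i : ℕ))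

/-! ### Injective homomorphism densities of partially labeled graphs

A word of length `k` over `[p]` with distinct characters is an embedding `Fin k ↪ Fin p`. -/

/-- `Inj(F^ℓ, G^α)`: injective homomorphisms `f` from `F` to `G` such that `f (ℓ_i) = α_i`. -/
def labeledInj {p k n : ℕ} (F : SimpleGraph (Fin p)) (ℓ : Fin k ↪ Fin p)
    (G : SimpleGraph (Fin n)) (α : Fin k ↪ Fin n) : Set (Fin p ↪ Fin n) :=
  {f | (∀ i j, F.Adj i j → G.Adj (f i) (f j)) ∧ ∀ i, f (ℓ i) = α i}

/-- `t_inj(F^ℓ, G^α) = |Inj(F^ℓ, G^α)| / A_{n-k}^{p-k}` (meaningful for `n ≥ p`). -/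
noncomputable def labeledInjDensity {p k n : ℕ} (F : SimpleGraph (Fin p)) (ℓ : Fin k ↪ Fin p)
    (G : SimpleGraph (Fin n)) (α : Fin k ↪ Fin n) : ℝ :=
  ((labeledInj F ℓ G α).ncard : ℝ) / ((n - k).descFactorial (p - k) : ℝ)

theorem labeledInj_ncard_le {p k n : ℕ} (F : SimpleGraph (Fin p)) (ℓ : Fin k ↪ Fin p)
    (G : SimpleGraph (Fin n)) (α : Fin k ↪ Fin n) :
    (labeledInj F ℓ G α).ncard ≤ (n - k).descFactorial (p - k) := by
  classical
  have hcard : Nat.card ({i // i ∉ Set.range ℓ} ↪ {j // j ∉ Set.range α})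
      = (n - k).descFactorial (p - k) := by
    rw [Nat.card_eq_fintype_card, Fintype.card_embedding_eq]
    congr 1
    · rw [Fintype.card_subtype_compl, Fintype.card_fin, ← Nat.card_eq_fintype_card,
        Nat.card_range_of_injective α.injective, Nat.card_eq_fintype_card, Fintype.card_fin]
    · rw [Fintype.card_subtype_compl, Fintype.card_fin, ← Nat.card_eq_fintype_card,
        Nat.card_range_of_injective ℓ.injective, Nat.card_eq_fintype_card, Fintype.card_fin]
  rw [← hcard, ← Nat.card_coe_set_eq]
  refine Nat.card_le_card_of_injective
    (fun f : labeledInj F ℓ G α =>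
      (⟨fun i => ⟨f.1 i.1, ?_⟩, ?_⟩ :
        {i // i ∉ Set.range ℓ} ↪ {j // j ∉ Set.range α})) ?_
  · rintro ⟨m, hm⟩
    refine i.2 ⟨m, ?_⟩
    apply f.1.injective
    rw [f.2.2 m, hm]
  · intro i j hij
    exact Subtype.ext (f.1.injective (congrArg Subtype.val hij))
  · intro f g hfg
    apply Subtype.ext
    ext i
    by_cases hi : i ∈ Set.range ℓ
    · obtain ⟨m, rfl⟩ := hi
      rw [f.2.2 m, g.2.2 m]
    · have := congrArg (fun e : {i // i ∉ Set.range ℓ} ↪ {j // j ∉ Set.range α} =>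
        ((e ⟨i, hi⟩).1 : ℕ)) hfg
      exact this

theorem labeledInjDensity_mem {p k n : ℕ} (F : SimpleGraph (Fin p)) (ℓ : Fin k ↪ Fin p)
    (G : SimpleGraph (Fin n)) (α : Fin k ↪ Fin n) :
    labeledInjDensity F ℓ G α ∈ Set.Icc (0 : ℝ) 1 :=
  ⟨by unfold labeledInjDensity; positivity,
    div_le_one_of_le₀ (by exact_mod_cast labeledInj_ncard_le F ℓ G α) (by positivity)⟩

/-- The vector `t_inj(F^ℓ, G^α) = (t_inj(F_m^ℓ, G^α) : m ∈ [d]) ∈ [0,1]^d`. -/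
noncomputable def densityVec {d p k n : ℕ} (F : Fin d → SimpleGraph (Fin p)) (ℓ : Fin k ↪ Fin p)
    (G : SimpleGraph (Fin n)) (α : Fin k ↪ Fin n) : Fin d → I :=
  fun m => ⟨labeledInjDensity (F m) ℓ G α, labeledInjDensity_mem (F m) ℓ G α⟩

/-- The empirical measure `Γ^{F,ℓ}(G) = |S_{n,k}|⁻¹ ∑_{α ∈ S_{n,k}} δ_{t_inj(F^ℓ, G^α)}` on
`[0,1]^d`, where `|S_{n,k}| = n! / (n-k)!`. -/
noncomputable def empiricalMeasure {d p k n : ℕ} (F : Fin d → SimpleGraph (Fin p))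
    (ℓ : Fin k ↪ Fin p) (G : SimpleGraph (Fin n)) : Measure (Fin d → I) :=
  ((n.descFactorial k : ℝ≥0∞))⁻¹ • ∑ α : Fin k ↪ Fin n, Measure.dirac (densityVec F ℓ G α)

theorem isProbabilityMeasure_empiricalMeasure {d p k n : ℕ} (hpn : p ≤ n)
    (F : Fin d → SimpleGraph (Fin p)) (ℓ : Fin k ↪ Fin p) (G : SimpleGraph (Fin n)) :
    IsProbabilityMeasure (empiricalMeasure F ℓ G) := by
  have hk : k ≤ n := le_trans (by simpa using Fintype.card_le_of_embedding ℓ) hpn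
  constructor
  simp only [empiricalMeasure, Measure.smul_apply, Measure.coe_finsetSum, Finset.sum_apply,
    measure_univ, Finset.sum_const, Finset.card_univ, Fintype.card_embedding_eq, Fintype.card_fin,
    smul_eq_mul, nsmul_eq_mul, mul_one]
  refine ENNReal.inv_mul_cancel ?_ (ENNReal.natCast_ne_top _)
  exact_mod_cast (Nat.descFactorial_pos.2 hk).ne'

/-- The random probability measure `Γ_n^{F,ℓ}`, as a function of the graph `G_n`, `n ≥ p`. -/
noncomputable def Gamma_n {d p k n : ℕ} (hpn : p ≤ n) (F : Fin d → SimpleGraph (Fin p))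
    (ℓ : Fin k ↪ Fin p) (G : SimpleGraph (Fin n)) : ProbabilityMeasure (Fin d → I) :=
  ⟨empiricalMeasure F ℓ G, isProbabilityMeasure_empiricalMeasure hpn F ℓ G⟩

/-! ### The limit measure -/

open Classical in
/-- `t̂_x(F^ℓ, W)`: the product of `W (x i) (x j)` over the pairs `i < j` in `[k]` such that
`{ℓ_i, ℓ_j}` is an edge of `F`. -/
noncomputable def tHat {p k : ℕ} (W : Graphon) (F : SimpleGraph (Fin p)) (ℓ : Fin k ↪ Fin p)
    (x : Fin k → I) : ℝ :=
  ∏ e : Fin k × Fin k with e.1 < e.2 ∧ F.Adj (ℓ e.1) (ℓ e.2), W (x e.1) (x e.2)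

open Classical in
/-- `Z̃(y)`: the product of `W (y i) (y j)` over the edges `{i, j}` of `F` whose endpoints are not
both labeled. -/
noncomputable def zTilde {p k : ℕ} (W : Graphon) (F : SimpleGraph (Fin p)) (ℓ : Fin k ↪ Fin p)
    (y : Fin p → I) : ℝ :=
  ∏ e : Fin p × Fin p with
    e.1 < e.2 ∧ F.Adj e.1 e.2 ∧ ¬(e.1 ∈ Set.range ℓ ∧ e.2 ∈ Set.range ℓ), W (y e.1) (y e.2)

/-- `t̃_x(F^ℓ, W)`: the average of `Z̃(y)` over the `y ∈ [0,1]^p` such that `y_ℓ = x`. The vector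
`Function.extend ℓ x z` has the coordinate `x i` at `ℓ i`, and `z m` at `m ∉ ℓ`; the coordinates
of `z` at labeled vertices are not used. -/
noncomputable def tTilde {p k : ℕ} (W : Graphon) (F : SimpleGraph (Fin p)) (ℓ : Fin k ↪ Fin p)
    (x : Fin k → I) : ℝ :=
  ∫ z : Fin p → I, zTilde W F ℓ (Function.extend ℓ x z)

theorem prod_graphon_mem (W : Graphon) {ι : Type*} (s : Finset ι) (u v : ι → I) :
    ∏ e ∈ s, W (u e) (v e) ∈ Set.Icc (0 : ℝ) 1 :=
  ⟨Finset.prod_nonneg fun _ _ => W.nonneg' _ _,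
    Finset.prod_le_one (fun _ _ => W.nonneg' _ _) fun _ _ => W.le_one' _ _⟩

theorem tHat_mem {p k : ℕ} (W : Graphon) (F : SimpleGraph (Fin p)) (ℓ : Fin k ↪ Fin p)
    (x : Fin k → I) : tHat W F ℓ x ∈ Set.Icc (0 : ℝ) 1 :=
  prod_graphon_mem W _ _ _

theorem measurable_tHat {p k : ℕ} (W : Graphon) (F : SimpleGraph (Fin p)) (ℓ : Fin k ↪ Fin p) :
    Measurable (tHat W F ℓ) := by
  unfold tHat
  refine Finset.measurable_prod _ fun e _ => ?_
  exact W.measurable'.comp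
    (Measurable.prodMk (measurable_pi_apply e.1) (measurable_pi_apply e.2))

theorem measurable_zTilde {p k : ℕ} (W : Graphon) (F : SimpleGraph (Fin p)) (ℓ : Fin k ↪ Fin p) :
    Measurable (zTilde W F ℓ) := by
  unfold zTilde
  refine Finset.measurable_prod _ fun e _ => ?_
  exact W.measurable'.comp
    (Measurable.prodMk (measurable_pi_apply e.1) (measurable_pi_apply e.2))

theorem measurable_extend {p k : ℕ} (ℓ : Fin k ↪ Fin p) :
    Measurable (fun q : (Fin k → I) × (Fin p → I) => Function.extend ℓ q.1 q.2) := by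
  refine measurable_pi_lambda _ fun m => ?_
  by_cases hm : ∃ i, ℓ i = m
  · obtain ⟨i, rfl⟩ := hm
    simp only [ℓ.injective.extend_apply]
    exact (measurable_pi_apply i).comp measurable_fst
  · simp only [Function.extend_apply' _ _ _ hm]
    exact (measurable_pi_apply m).comp measurable_snd

theorem tTilde_mem {p k : ℕ} (W : Graphon) (F : SimpleGraph (Fin p)) (ℓ : Fin k ↪ Fin p)
    (x : Fin k → I) : tTilde W F ℓ x ∈ Set.Icc (0 : ℝ) 1 := by
  refine ⟨integral_nonneg fun z => (prod_graphon_mem W _ _ _).1, ?_⟩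
  have hb : ∀ z : Fin p → I, ‖zTilde W F ℓ (Function.extend ℓ x z)‖ ≤ 1 := fun z => by
    rw [Real.norm_eq_abs, abs_le]
    exact ⟨by linarith [(show 0 ≤ zTilde W F ℓ (Function.extend ℓ x z) from
      (prod_graphon_mem W _ _ _).1)], (prod_graphon_mem W _ _ _).2⟩
  have := norm_integral_le_of_norm_le_const (μ := (volume : Measure (Fin p → I)))
    (Eventually.of_forall hb)
  rw [probReal_univ, mul_one] at this
  exact (le_abs_self _).trans this

theorem measurable_tTilde {p k : ℕ} (W : Graphon) (F : SimpleGraph (Fin p)) (ℓ : Fin k ↪ Fin p) :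
    Measurable (tTilde W F ℓ) :=
  (StronglyMeasurable.integral_prod_right' (ν := (volume : Measure (Fin p → I)))
    ((measurable_zTilde W F ℓ).comp (measurable_extend ℓ)).stronglyMeasurable).measurable

/-- The vector `t̃_x(F^ℓ, W) = (t̃_x(F_m^ℓ, W) : m ∈ [d]) ∈ [0,1]^d`. -/
noncomputable def tTildeVec {d p k : ℕ} (W : Graphon) (F : Fin d → SimpleGraph (Fin p))
    (ℓ : Fin k ↪ Fin p) (x : Fin k → I) : Fin d → I :=
  fun m => ⟨tTilde W (F m) ℓ x, tTilde_mem W (F m) ℓ x⟩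

theorem measurable_tTildeVec {d p k : ℕ} (W : Graphon) (F : Fin d → SimpleGraph (Fin p))
    (ℓ : Fin k ↪ Fin p) : Measurable (tTildeVec W F ℓ) :=
  measurable_pi_lambda _ fun m => (measurable_tTilde W (F m) ℓ).subtype_mk

/-- The induced labeled subgraph on the vertices `ℓ_1, …, ℓ_k` is the same for all `F_m`. -/
def SameLabeledSubgraph {d p k : ℕ} (F : Fin d → SimpleGraph (Fin p)) (ℓ : Fin k ↪ Fin p) : Prop :=
  ∀ m m' : Fin d, ∀ i i' : Fin k, (F m).Adj (ℓ i) (ℓ i') ↔ (F m').Adj (ℓ i) (ℓ i')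

/-- The measure `g ↦ ∫ t̂_x(F^ℓ, W) g(t̃_x(F^ℓ, W)) dx + (1 - ∫ t̂_x(F^ℓ, W) dx) g(0)` on
`[0,1]^d`. Here `t̂_x(F^ℓ, W)` is the common value of the `t̂_x(F_m^ℓ, W)`, `m ∈ [d]`, when the
labeled subgraph is the same for all `F_m`; it is computed from the first graph. -/
noncomputable def limitMeasure {d p k : ℕ} [NeZero d] (W : Graphon)
    (F : Fin d → SimpleGraph (Fin p)) (ℓ : Fin k ↪ Fin p) : Measure (Fin d → I) :=
  (volume.withDensity fun x : Fin k → I => ENNReal.ofReal (tHat W (F 0) ℓ x)).map (tTildeVec W F ℓ)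
    + ENNReal.ofReal (1 - ∫ x : Fin k → I, tHat W (F 0) ℓ x) • Measure.dirac 0

theorem isProbabilityMeasure_limitMeasure {d p k : ℕ} [NeZero d] (W : Graphon)
    (F : Fin d → SimpleGraph (Fin p)) (ℓ : Fin k ↪ Fin p) :
    IsProbabilityMeasure (limitMeasure W F ℓ) := by
  have hint : Integrable (tHat W (F 0) ℓ) (volume : Measure (Fin k → I)) :=
    Integrable.of_bound (measurable_tHat W (F 0) ℓ).aestronglyMeasurable 1
      (Eventually.of_forall fun x => by
        rw [Real.norm_eq_abs, abs_le]
        exact ⟨by linarith [(tHat_mem W (F 0) ℓ x).1], (tHat_mem W (F 0) ℓ x).2⟩)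
  have h0 : 0 ≤ ∫ x : Fin k → I, tHat W (F 0) ℓ x :=
    integral_nonneg fun x => (tHat_mem W (F 0) ℓ x).1
  have h1 : ∫ x : Fin k → I, tHat W (F 0) ℓ x ≤ 1 := by
    have := integral_mono hint (integrable_const (1 : ℝ)) fun x => (tHat_mem W (F 0) ℓ x).2
    simpa using this
  constructor
  rw [limitMeasure, Measure.add_apply, Measure.map_apply (measurable_tTildeVec W F ℓ) .univ,
    Set.preimage_univ, withDensity_apply _ .univ, Measure.restrict_univ,
    ← ofReal_integral_eq_lintegral_ofReal hint
      (Eventually.of_forall fun x => (tHat_mem W (F 0) ℓ x).1),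
    Measure.smul_apply, measure_univ, smul_eq_mul, mul_one,
    ← ENNReal.ofReal_add h0 (by linarith)]
  simp

/-- The deterministic probability measure `Γ^{F,ℓ}` on `[0,1]^d`. -/
noncomputable def Gamma {d p k : ℕ} [NeZero d] (W : Graphon)
    (F : Fin d → SimpleGraph (Fin p)) (ℓ : Fin k ↪ Fin p) : ProbabilityMeasure (Fin d → I) :=
  ⟨limitMeasure W F ℓ, isProbabilityMeasure_limitMeasure W F ℓ⟩

/-! ### Degrees -/

/-- The normalized degree function `D(x) = ∫ W(x, y) dy` of a graphon. -/
noncomputable def degreeFun (W : Graphon) (x : I) : ℝ :=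
  ∫ y : I, W x y

/-- The normalized degree `D_i(G) = (n - 1)⁻¹ |{j : {i, j} ∈ E(G)}|` of a vertex of a graph with
`n` vertices. -/
noncomputable def normalizedDegree {n : ℕ} (G : SimpleGraph (Fin n)) (i : Fin n) : ℝ :=
  ((G.neighborSet i).ncard : ℝ) / ((n : ℝ) - 1)

open Classical in
/-- The empirical CDF of the normalized degrees, `Π(y) = n⁻¹ ∑_i 1{D_i(G) ≤ D(y)}`. -/
noncomputable def degreeCDF {n : ℕ} (W : Graphon) (G : SimpleGraph (Fin n)) (y : I) : ℝ :=
  (∑ i : Fin n, if normalizedDegree G i ≤ degreeFun W y then (1 : ℝ) else 0) / (n : ℝ)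

end GraphonLLN

open GraphonLLN

namespace GraphonLLN

/-! ### Counting injective words -/

/-! The proof is by moments. On the compact cube, weak convergence follows from convergence of all
mixed moments by Stone–Weierstrass (`tendsto_of_tendsto_moments`). Moments are indexed by lists of
coordinates, so there are countably many and a single null set suffices.

The moment of the empirical measure along `m₁, …, m_r` is the average over words `α` of a product of
labeled densities. Up to `O(1/n)`, injectivity can be dropped, and the average becomes the
homomorphism density in `G_n` of one graph: copies of `F_{m₁}, …, F_{m_r}` glued along their labeled
vertices (`homDensity_glue`, `abs_average_prod_labeledInjDensity_sub_homDensity_le`). Because the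
labeled subgraphs agree, each labeled edge occurs once in the glued graph. Its density in `W` is
therefore `∫ t̂_x ∏ t̃_x(F_{m_s}) dx`, with `t̂_x` to the power one whatever `r ≥ 1`
(`graphonDensity_glue`). This is the corresponding moment of the limit measure, whose atom at `0`
contributes nothing when `r ≥ 1`.

It remains to see that homomorphism densities converge almost surely
(`IsWRandomGraph.ae_tendsto_homDensity`). Copies on disjoint vertex sets are uncorrelated, so the
mean squared error is `O(1/n)`. This is summable along squares, and monotonicity of the counts fills
the gaps.

For degrees, take a single edge with one labeled endpoint. The limit is the law of `D` under
Lebesgue measure, which has no atoms when `D` is strictly increasing. The portmanteau theorem gives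
pointwise convergence of the distribution functions, and monotonicity makes it uniform. -/

theorem one_sub_sq_div_le_descFactorial_div_pow (n q : ℕ) (hn : 0 < n) :
    1 - (q : ℝ) ^ 2 / n ≤ (n.descFactorial q : ℝ) / (n : ℝ) ^ q := by
  have hn' : (0 : ℝ) < n := by exact_mod_cast hn
  induction q with
  | zero => simp
  | succ q ih =>
    have hle : (n.descFactorial q : ℝ) / (n : ℝ) ^ q ≤ 1 := by
      apply div_le_one_of_le₀ _ (by positivity)
      exact_mod_cast Nat.descFactorial_le_pow n q
    have hsub : (n : ℝ) - q ≤ ((n - q : ℕ) : ℝ) := by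
      have : (n : ℝ) ≤ ((n - q : ℕ) : ℝ) + q := by exact_mod_cast (by omega)
      linarith
    have hstep : (n.descFactorial (q + 1) : ℝ) / (n : ℝ) ^ (q + 1)
        = (n.descFactorial q : ℝ) / (n : ℝ) ^ q * (((n - q : ℕ) : ℝ) / n) := by
      rw [Nat.descFactorial_succ, pow_succ]
      push_cast
      field_simp
    have hfac : 1 - (q : ℝ) / n ≤ ((n - q : ℕ) : ℝ) / n := by
      rw [one_sub_div hn'.ne']
      gcongr
    have h0 : 0 ≤ (n.descFactorial q : ℝ) / (n : ℝ) ^ q := by positivity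
    have hq : (0 : ℝ) ≤ q / n := by positivity
    have hexp : ((q + 1 : ℕ) : ℝ) ^ 2 / n = (q : ℝ) ^ 2 / n + 2 * (q / n) + 1 / n := by
      push_cast
      field_simp
      ring
    have h1n : (0 : ℝ) ≤ 1 / n := by positivity
    rw [hstep, hexp]
    nlinarith [mul_le_mul_of_nonneg_left hfac h0, mul_nonneg hq (sub_nonneg.2 hle)]

theorem card_filter_injective (V : Type*) [Fintype V] [DecidableEq V] (n : ℕ)
    [DecidablePred (Function.Injective : (V → Fin n) → Prop)] :
    (Finset.univ.filter (Function.Injective : (V → Fin n) → Prop)).card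
      = n.descFactorial (Fintype.card V) := by
  rw [← Fintype.card_subtype, Fintype.card_congr (Equiv.subtypeInjectiveEquivEmbedding V (Fin n)),
    Fintype.card_embedding_eq, Fintype.card_fin]

theorem card_filter_not_injective_le (V : Type*) [Fintype V] [DecidableEq V] (n : ℕ) (hn : 0 < n)
    [DecidablePred fun f : V → Fin n => ¬ Function.Injective f] :
    ((Finset.univ.filter fun f : V → Fin n => ¬ Function.Injective f).card : ℝ)
      ≤ (Fintype.card V : ℝ) ^ 2 / n * (n : ℝ) ^ Fintype.card V := by
  classical
  have hn' : (0 : ℝ) < n := by exact_mod_cast hn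
  have hsum := Finset.card_filter_add_card_filter_not (s := (Finset.univ : Finset (V → Fin n)))
    (fun f => Function.Injective f)
  rw [card_filter_injective, Finset.card_univ, Fintype.card_fun, Fintype.card_fin] at hsum
  have hsum' : (n.descFactorial (Fintype.card V) : ℝ)
      + ((Finset.univ.filter fun f : V → Fin n => ¬ Function.Injective f).card : ℝ)
      = (n : ℝ) ^ Fintype.card V := by exact_mod_cast hsum
  have h := one_sub_sq_div_le_descFactorial_div_pow n (Fintype.card V) hn
  rw [le_div_iff₀ (by positivity)] at h
  linarith

/-- Averages of a `[0,1]`-valued function over a finite type and over a subset of it differ by at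
most the proportion of the complement. -/
theorem abs_average_subset_sub_average_le {A : Type*} [Fintype A] (B : Finset A) (c : A → ℝ)
    (h0 : ∀ x, 0 ≤ c x) (h1 : ∀ x, c x ≤ 1) (hB : B.Nonempty) :
    |(∑ x ∈ B, c x) / B.card - (∑ x, c x) / Fintype.card A|
      ≤ 1 - (B.card : ℝ) / Fintype.card A := by
  classical
  have hb : (0 : ℝ) < B.card := by exact_mod_cast hB.card_pos
  have hba : (B.card : ℝ) ≤ Fintype.card A := by exact_mod_cast B.card_le_univ
  have ha : (0 : ℝ) < Fintype.card A := hb.trans_le hba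
  have hsplit : ∑ x, c x = ∑ x ∈ B, c x + ∑ x ∈ Bᶜ, c x :=
    (Finset.sum_add_sum_compl B c).symm
  have hs0 : 0 ≤ ∑ x ∈ B, c x := Finset.sum_nonneg fun _ _ => h0 _
  have hs1 : ∑ x ∈ B, c x ≤ B.card := by
    simpa using Finset.sum_le_sum (s := B) fun x _ => h1 x
  have hc0 : 0 ≤ ∑ x ∈ Bᶜ, c x := Finset.sum_nonneg fun _ _ => h0 _
  have hc1 : ∑ x ∈ Bᶜ, c x ≤ Fintype.card A - B.card := by
    have := Finset.sum_le_sum (s := Bᶜ) fun x _ => h1 x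
    rw [Finset.sum_const, nsmul_one, Finset.card_compl, Nat.cast_sub B.card_le_univ] at this
    exact this
  set s := ∑ x ∈ B, c x
  set r := ∑ x ∈ Bᶜ, c x
  set b : ℝ := (B.card : ℝ)
  set a : ℝ := (Fintype.card A : ℝ)
  have hsb : s / b ≤ 1 := div_le_one_of_le₀ hs1 hb.le
  have hsb0 : 0 ≤ s / b := by positivity
  have hba1 : b / a ≤ 1 := div_le_one_of_le₀ hba ha.le
  have hra : r / a ≤ 1 - b / a := by
    rw [one_sub_div ha.ne']
    gcongr
  have hra0 : 0 ≤ r / a := by positivity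
  have hsa : s / a = s / b * (b / a) := by field_simp
  rw [hsplit, add_div, hsa, abs_le]
  -- The difference is `(s / b) * (1 - b / a) - r / a`, and both terms lie in `[0, 1 - b / a]`.
  constructor <;> nlinarith

theorem abs_prod_sub_prod_le_sum {ι : Type*} (s : Finset ι) (u v : ι → ℝ)
    (hu : ∀ i, u i ∈ Set.Icc (0 : ℝ) 1) (hv : ∀ i, v i ∈ Set.Icc (0 : ℝ) 1) :
    |∏ i ∈ s, u i - ∏ i ∈ s, v i| ≤ ∑ i ∈ s, |u i - v i| := by
  classical
  induction s using Finset.induction_on with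
  | empty => simp
  | insert a s ha ih =>
    rw [Finset.prod_insert ha, Finset.prod_insert ha, Finset.sum_insert ha]
    have hP0 : 0 ≤ ∏ i ∈ s, u i := Finset.prod_nonneg fun i _ => (hu i).1
    have hP1 : ∏ i ∈ s, u i ≤ 1 := Finset.prod_le_one (fun i _ => (hu i).1) fun i _ => (hu i).2
    have heq : u a * ∏ i ∈ s, u i - v a * ∏ i ∈ s, v i
        = (u a - v a) * ∏ i ∈ s, u i + v a * (∏ i ∈ s, u i - ∏ i ∈ s, v i) := by ring
    rw [heq]
    refine (abs_add_le _ _).trans (add_le_add ?_ ?_)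
    · rw [abs_mul, abs_of_nonneg hP0]
      exact mul_le_of_le_one_right (abs_nonneg _) hP1
    · rw [abs_mul, abs_of_nonneg (hv a).1]
      exact (mul_le_of_le_one_left (abs_nonneg _) (hv a).2).trans ih

/-! ### Homomorphism densities of multigraphs given by an indexed family of edges -/

/-- The indicator that `f` sends each pair `{a i, b i}` to an edge of `G`. -/
noncomputable def homIndicator {ι V U : Type*} (a b : ι → V) (G : SimpleGraph U) (f : V → U) : ℝ :=
  Set.indicator {f | ∀ i, G.Adj (f (a i)) (f (b i))} 1 f

/-- The proportion of maps `V → [n]` which send each pair `{a i, b i}` to an edge of `G`. -/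
noncomputable def homDensity {ι V : Type*} [Fintype V] [DecidableEq V] (a b : ι → V)
    (G : SimpleGraph ℕ) (n : ℕ) : ℝ :=
  (∑ f : V → Fin n, homIndicator a b G (fun v => (f v : ℕ))) / (n : ℝ) ^ Fintype.card V

/-- `t(H, W)` for the graph `H` on `V` with edges `{a i, b i}`. -/
noncomputable def graphonDensity {ι V : Type*} [Fintype ι] [Fintype V] (a b : ι → V)
    (W : Graphon) : ℝ :=
  ∫ y : V → I, ∏ i, W (y (a i)) (y (b i))

theorem homIndicator_nonneg {ι V U : Type*} (a b : ι → V) (G : SimpleGraph U) (f : V → U) :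
    0 ≤ homIndicator a b G f :=
  Set.indicator_nonneg (fun _ _ => zero_le_one) _

theorem homIndicator_le_one {ι V U : Type*} (a b : ι → V) (G : SimpleGraph U) (f : V → U) :
    homIndicator a b G f ≤ 1 :=
  Set.indicator_le_self' (fun _ _ => zero_le_one) _

theorem graphonDensity_mem {ι V : Type*} [Fintype ι] [Fintype V] (a b : ι → V) (W : Graphon) :
    graphonDensity a b W ∈ Set.Icc (0 : ℝ) 1 := by
  refine ⟨integral_nonneg fun y => (prod_graphon_mem W _ _ _).1, ?_⟩
  have hb : ∀ y : V → I, ‖∏ i, W (y (a i)) (y (b i))‖ ≤ 1 := fun y => by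
    have h := prod_graphon_mem W Finset.univ (fun i => y (a i)) (fun i => y (b i))
    rw [Real.norm_of_nonneg h.1]
    exact h.2
  have := norm_integral_le_of_norm_le_const (μ := (volume : Measure (V → I)))
    (Eventually.of_forall hb)
  rw [probReal_univ, mul_one] at this
  exact (le_abs_self _).trans this

theorem measurable_prod_graphon (W : Graphon) {ι V : Type*} [Fintype ι] (a b : ι → V) :
    Measurable fun y : V → I => ∏ i, W (y (a i)) (y (b i)) := by
  refine Finset.measurable_prod _ fun i _ => ?_
  have h : Measurable fun y : V → I => (y (a i), y (b i)) :=
    (measurable_pi_apply (a i)).prodMk (measurable_pi_apply (b i))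
  exact W.measurable'.comp h

/-! ### Expected number of copies in a `W`-random graph -/

section Random

variable {Ω : Type*} [MeasurableSpace Ω] {P : Measure Ω}
  {W : Graphon} {X : ℕ → Ω → I} {G : Ω → SimpleGraph ℕ}

theorem IsWRandomGraph.map_comp_eq_volume [IsProbabilityMeasure P] (hG : IsWRandomGraph W P X G) {V : Type*} [Fintype V]
    {f : V → ℕ} (hf : Function.Injective f) :
    P.map (fun ω v => X (f v) ω) = (volume : Measure (V → I)) := by
  have h := (iIndepFun_iff_map_fun_eq_pi_map
    (fun v => (hG.measurable_X (f v)).aemeasurable)).1 (hG.iIndepFun_X.precomp hf)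
  rw [h]
  simp_rw [hG.uniform_X]
  rfl

theorem IsWRandomGraph.measurableSet_hom (hG : IsWRandomGraph W P X G) {ι V : Type*} [Countable ι]
    (a b : ι → V) (f : V → ℕ) :
    MeasurableSet {ω | ∀ i, (G ω).Adj (f (a i)) (f (b i))} := by
  rw [Set.ofPred_forall]
  exact MeasurableSet.iInter fun i => hG.measurableSet_adj _ _

theorem IsWRandomGraph.measurable_homIndicator (hG : IsWRandomGraph W P X G) {ι V : Type*}
    [Countable ι] (a b : ι → V) (f : V → ℕ) :
    Measurable fun ω => homIndicator a b (G ω) f := by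
  have : (fun ω => homIndicator a b (G ω) f)
      = Set.indicator {ω | ∀ i, (G ω).Adj (f (a i)) (f (b i))} 1 := by
    ext ω
    simp [homIndicator, Set.indicator]
  rw [this]
  exact measurable_one.indicator (hG.measurableSet_hom a b f)

/-- The expected number of copies of a graph at given distinct vertices. -/
theorem IsWRandomGraph.integral_homIndicator [IsProbabilityMeasure P] (hG : IsWRandomGraph W P X G) {ι V : Type*}
    [Fintype ι] [Fintype V] {a b : ι → V} (hab : ∀ i, a i ≠ b i)
    (hinj : Function.Injective fun i => s(a i, b i)) {f : V → ℕ} (hf : Function.Injective f) :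
    ∫ ω, homIndicator a b (G ω) f ∂P = graphonDensity a b W := by
  classical
  -- `condProb_edges` only speaks of increasing pairs, so each edge is reoriented; symmetry of `W`
  -- makes this harmless. Injectivity of `e` ensures that each edge contributes exactly one factor.
  let e : ι → ℕ × ℕ := fun i => (min (f (a i)) (f (b i)), max (f (a i)) (f (b i)))
  have he : Function.Injective e := by
    intro i j hij
    apply hinj
    have hsym : s(f (a i), f (b i)) = s(f (a j), f (b j)) := by
      simp only [e, Prod.mk.injEq] at hij
      rw [Sym2.eq_iff]
      rcases le_total (f (a i)) (f (b i)) with h | h <;>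
        rcases le_total (f (a j)) (f (b j)) with h' | h' <;>
        simp [h, h'] at hij <;> tauto
    exact Sym2.map.injective hf hsym
  have hlt : ∀ q ∈ Finset.univ.image e, q.1 < q.2 := by
    intro q hq
    obtain ⟨i, -, rfl⟩ := Finset.mem_image.1 hq
    exact min_lt_max.2 fun h => hab i (hf h)
  have hadj : ∀ ω i, (G ω).Adj (e i).1 (e i).2 ↔ (G ω).Adj (f (a i)) (f (b i)) := by
    intro ω i
    rcases le_total (f (a i)) (f (b i)) with h | h <;> simp [e, h, SimpleGraph.adj_comm]
  have hW : ∀ ω i, W (X (e i).1 ω) (X (e i).2 ω) = W (X (f (a i)) ω) (X (f (b i)) ω) := by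
    intro ω i
    rcases le_total (f (a i)) (f (b i)) with h | h <;> simp [e, h]
    exact W.symm' _ _
  have hset : {ω | ∀ q ∈ Finset.univ.image e, (G ω).Adj q.1 q.2}
      = {ω | ∀ i, (G ω).Adj (f (a i)) (f (b i))} := by
    ext ω
    simp [hadj]
  have hcond := hG.condProb_edges (Finset.univ.image e) hlt
  rw [hset] at hcond
  have hm : MeasurableSpace.comap (fun ω i => X i ω) (inferInstance : MeasurableSpace (ℕ → I))
      ≤ (inferInstance : MeasurableSpace Ω) :=
    (measurable_pi_lambda _ hG.measurable_X).comap_le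
  have hI : (fun ω => homIndicator a b (G ω) f)
      = Set.indicator {ω | ∀ i, (G ω).Adj (f (a i)) (f (b i))} fun _ => (1 : ℝ) := by
    ext ω
    simp [homIndicator, Set.indicator]
  rw [hI, ← integral_condExp hm, integral_congr_ae hcond, graphonDensity,
    ← hG.map_comp_eq_volume hf, integral_map]
  · refine integral_congr_ae (Eventually.of_forall fun ω => ?_)
    simp only [Finset.prod_image he.injOn, hW]
  · exact (measurable_pi_lambda _ fun v => hG.measurable_X (f v)).aemeasurable
  · exact (measurable_prod_graphon W a b).aestronglyMeasurable

end Random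

/-! ### Almost sure convergence of homomorphism densities -/

/-- Two copies form one copy of the disjoint union of the graph with itself. Together with
`graphonDensity_sum`, this turns a second moment into a first moment. -/
theorem homIndicator_sumElim {ι V U : Type*} (a b : ι → V) (G : SimpleGraph U) (f g : V → U) :
    homIndicator (Sum.map a a) (Sum.map b b) G (Sum.elim f g)
      = homIndicator a b G f * homIndicator a b G g := by
  classical
  simp only [homIndicator, Set.indicator, Set.mem_ofPred_eq, Sum.forall, Sum.map_inl, Sum.map_inr,
    Sum.elim_inl, Sum.elim_inr, Pi.one_apply]
  split_ifs <;> simp_all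

theorem graphonDensity_sum (W : Graphon) {ι V : Type*} [Fintype ι] [Fintype V] (a b : ι → V) :
    graphonDensity (Sum.map a a) (Sum.map b b) W = graphonDensity a b W ^ 2 := by
  have h := (volume_measurePreserving_sumPiEquivProdPi (fun _ : V ⊕ V => I)).integral_comp'
    (fun q => (∏ i, W (q.1 (a i)) (q.1 (b i))) * ∏ i, W (q.2 (a i)) (q.2 (b i)))
  rw [graphonDensity, sq, graphonDensity, ← integral_prod_mul]
  simp only [Fintype.prod_sum_type]
  exact h

theorem homDensity_mem {ι V : Type*} [Fintype V] [DecidableEq V] (a b : ι → V) (G : SimpleGraph ℕ)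
    (n : ℕ) : homDensity a b G n ∈ Set.Icc (0 : ℝ) 1 := by
  refine ⟨div_nonneg (Finset.sum_nonneg fun _ _ => homIndicator_nonneg _ _ _ _) (by positivity),
    div_le_one_of_le₀ ?_ (by positivity)⟩
  refine (Finset.sum_le_sum fun _ _ => homIndicator_le_one _ _ _ _).trans ?_
  simp

theorem homCount_mono {ι V : Type*} [Fintype V] [DecidableEq V] (a b : ι → V) (G : SimpleGraph ℕ)
    {m n : ℕ} (hmn : m ≤ n) :
    ∑ f : V → Fin m, homIndicator a b G (fun v => (f v : ℕ))
      ≤ ∑ f : V → Fin n, homIndicator a b G (fun v => (f v : ℕ)) := by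
  classical
  let j : (V → Fin m) → (V → Fin n) := fun f v => Fin.castLE hmn (f v)
  have hj : Function.Injective j := fun f g h => by
    funext v
    exact Fin.castLE_injective hmn (congrFun h v)
  calc ∑ f : V → Fin m, homIndicator a b G (fun v => (f v : ℕ))
      = ∑ f ∈ Finset.univ.image j, homIndicator a b G (fun v => (f v : ℕ)) := by
        rw [Finset.sum_image hj.injOn]
        rfl
    _ ≤ _ := Finset.sum_le_sum_of_subset_of_nonneg (Finset.subset_univ _)
        fun _ _ _ => homIndicator_nonneg _ _ _ _

/-- A bounded nondecreasing count normalized by `n ^ q` converges as soon as it converges along the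
squares. -/
theorem tendsto_div_pow_of_tendsto_sq (N : ℕ → ℝ) (hN : Monotone N) (hN0 : ∀ n, 0 ≤ N n) (q : ℕ)
    (t : ℝ)
    (h : Tendsto (fun j : ℕ => N ((j + 1) ^ 2) / (((j + 1) ^ 2 : ℕ) : ℝ) ^ q) atTop (𝓝 t)) :
    Tendsto (fun n => N n / (n : ℝ) ^ q) atTop (𝓝 t) := by
  have h' : Tendsto (fun j : ℕ => N (j ^ 2) / ((j ^ 2 : ℕ) : ℝ) ^ q) atTop (𝓝 t) :=
    (tendsto_add_atTop_iff_nat (f := fun j : ℕ => N (j ^ 2) / ((j ^ 2 : ℕ) : ℝ) ^ q) 1).1 h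
  have hsqrt : Tendsto Nat.sqrt atTop atTop :=
    tendsto_atTop_mono' _ (Eventually.of_forall fun n => le_rfl)
      (tendsto_atTop.2 fun b => (eventually_ge_atTop (b * b)).mono fun n hn => Nat.le_sqrt.2 hn)
  have hr : Tendsto (fun j : ℕ => (((j : ℝ) / (j + 1)) ^ 2) ^ q) atTop (𝓝 1) := by
    have := ((tendsto_natCast_div_add_atTop (1 : ℝ)).pow 2).pow q
    simpa using this
  have hlow : Tendsto (fun j : ℕ => N (j ^ 2) / ((j ^ 2 : ℕ) : ℝ) ^ q
      * (((j : ℝ) / (j + 1)) ^ 2) ^ q) atTop (𝓝 t) := by simpa using h'.mul hr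
  have hupp : Tendsto (fun j : ℕ => N ((j + 1) ^ 2) / (((j + 1) ^ 2 : ℕ) : ℝ) ^ q
      / (((j : ℝ) / (j + 1)) ^ 2) ^ q) atTop (𝓝 t) := by
    simpa [Pi.div_def] using h.div hr one_ne_zero
  -- With `j = n.sqrt`, so that `j² ≤ n < (j + 1)²`, the ratio lies between `N (j²) / (j + 1)^(2q)`
  -- and `N ((j + 1)²) / j^(2q)`.
  refine tendsto_of_tendsto_of_tendsto_of_le_of_le' (hlow.comp hsqrt) (hupp.comp hsqrt) ?_ ?_
  · filter_upwards [eventually_ge_atTop 1] with n hn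
    have hs : 0 < n.sqrt := Nat.sqrt_pos.2 hn
    have hs' : (0 : ℝ) < n.sqrt := by exact_mod_cast hs
    have hn' : (0 : ℝ) < n := by exact_mod_cast hn
    have hle : (n : ℝ) ≤ ((n.sqrt : ℝ) + 1) ^ 2 := by
      exact_mod_cast (Nat.lt_succ_sqrt' n).le
    have hl : N (n.sqrt ^ 2) ≤ N n := hN (Nat.sqrt_le' n)
    simp only [Function.comp]
    push_cast
    rw [div_pow, div_pow, div_mul_div_cancel₀ (by positivity)]
    exact div_le_div₀ (hN0 _) hl (by positivity) (by gcongr)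
  · filter_upwards [eventually_ge_atTop 1] with n hn
    have hs : 0 < n.sqrt := Nat.sqrt_pos.2 hn
    have hs' : (0 : ℝ) < n.sqrt := by exact_mod_cast hs
    have hn' : (0 : ℝ) < n := by exact_mod_cast hn
    have hle : (n.sqrt : ℝ) ^ 2 ≤ n := by exact_mod_cast Nat.sqrt_le' n
    have hl : N n ≤ N ((n.sqrt + 1) ^ 2) := hN (Nat.lt_succ_sqrt' n).le
    simp only [Function.comp]
    push_cast
    rw [div_pow, div_pow, div_div_div_cancel_right₀ (by positivity)]
    exact div_le_div₀ (hN0 _) hl (by positivity) (by gcongr)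

/-! ### Second moments and almost sure convergence -/

section Random

variable {Ω : Type*} [MeasurableSpace Ω] {P : Measure Ω} {W : Graphon} {X : ℕ → Ω → I}
  {G : Ω → SimpleGraph ℕ}

theorem IsWRandomGraph.measurable_homDensity (hG : IsWRandomGraph W P X G) {ι V : Type*}
    [Countable ι] [Fintype V] [DecidableEq V] (a b : ι → V) (n : ℕ) :
    Measurable fun ω => homDensity a b (G ω) n :=
  (Finset.measurable_sum _ fun _ _ => hG.measurable_homIndicator a b _).div_const _

variable [IsProbabilityMeasure P]

theorem IsWRandomGraph.integrable_homIndicator (hG : IsWRandomGraph W P X G) {ι V : Type*}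
    [Countable ι] (a b : ι → V) (f : V → ℕ) : Integrable (fun ω => homIndicator a b (G ω) f) P :=
  Integrable.of_bound (hG.measurable_homIndicator a b f).aestronglyMeasurable 1
    (Eventually.of_forall fun ω => by
      rw [Real.norm_of_nonneg (homIndicator_nonneg _ _ _ _)]
      exact homIndicator_le_one _ _ _ _)

/-- Copies at disjoint vertex sets are uncorrelated. -/
theorem IsWRandomGraph.integral_homIndicator_sub_mul (hG : IsWRandomGraph W P X G) {ι V : Type*}
    [Fintype ι] [Fintype V] {a b : ι → V} (hab : ∀ i, a i ≠ b i)
    (hinj : Function.Injective fun i => s(a i, b i)) {f g : V → ℕ}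
    (hfg : Function.Injective (Sum.elim f g)) :
    ∫ ω, (homIndicator a b (G ω) f - graphonDensity a b W)
      * (homIndicator a b (G ω) g - graphonDensity a b W) ∂P = 0 := by
  set t := graphonDensity a b W
  have hf : Function.Injective f := fun x y h => Sum.inl_injective (hfg (by simpa using h))
  have hg : Function.Injective g := fun x y h => Sum.inr_injective (hfg (by simpa using h))
  have hinj2 : Function.Injective fun i => s(Sum.map a a i, Sum.map b b i) := by
    rintro (i | i) (j | j) h
    · refine congrArg Sum.inl (hinj ?_)
      simpa using h
    · simp at h
    · simp at h
    · refine congrArg Sum.inr (hinj ?_)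
      simpa using h
  have hprod := hG.integral_homIndicator (a := Sum.map a a) (b := Sum.map b b)
    (by rintro (i | i) <;> simpa using hab i) hinj2 hfg
  simp only [homIndicator_sumElim, graphonDensity_sum] at hprod
  have hi := hG.integrable_homIndicator (Sum.map a a) (Sum.map b b) (Sum.elim f g)
  simp only [homIndicator_sumElim] at hi
  have hif := hG.integrable_homIndicator a b f
  have hig := hG.integrable_homIndicator a b g
  have hexp : ∀ ω, (homIndicator a b (G ω) f - t) * (homIndicator a b (G ω) g - t)
      = homIndicator a b (G ω) f * homIndicator a b (G ω) g - t * homIndicator a b (G ω) f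
        - t * homIndicator a b (G ω) g + t ^ 2 := fun ω => by ring
  have hi1 : Integrable (fun ω => homIndicator a b (G ω) f * homIndicator a b (G ω) g
      - t * homIndicator a b (G ω) f) P := hi.sub (hif.const_mul t)
  have hi2 : Integrable (fun ω => homIndicator a b (G ω) f * homIndicator a b (G ω) g
      - t * homIndicator a b (G ω) f - t * homIndicator a b (G ω) g) P := hi1.sub (hig.const_mul t)
  simp only [hexp]
  rw [integral_add hi2 (integrable_const _), integral_sub hi1 (hig.const_mul t),
    integral_sub hi (hif.const_mul t),
    integral_const_mul, integral_const_mul, hprod, hG.integral_homIndicator hab hinj hf,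
    hG.integral_homIndicator hab hinj hg]
  simp only [integral_const, probReal_univ, one_smul]
  ring

/-- The square of the centered sum expands over maps `V ⊕ V → Fin n`. Injective maps contribute zero
since disjoint copies are uncorrelated; the others contribute at most `1` each, and their proportion
is at most `(2|V|)² / n`. -/
theorem IsWRandomGraph.integral_homDensity_sub_sq_le (hG : IsWRandomGraph W P X G) {ι V : Type*}
    [Fintype ι] [Fintype V] [DecidableEq V] {a b : ι → V} (hab : ∀ i, a i ≠ b i)
    (hinj : Function.Injective fun i => s(a i, b i)) {n : ℕ} (hn : 0 < n) :
    ∫ ω, (homDensity a b (G ω) n - graphonDensity a b W) ^ 2 ∂P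
      ≤ (2 * Fintype.card V : ℝ) ^ 2 / n := by
  classical
  set t := graphonDensity a b W with ht
  have ht01 := graphonDensity_mem a b W
  have hn' : (0 : ℝ) < n := by exact_mod_cast hn
  let c : (V → Fin n) → Ω → ℝ := fun f ω => homIndicator a b (G ω) (fun v => (f v : ℕ)) - t
  have hcint : ∀ f g, Integrable (fun ω => c f ω * c g ω) P := by
    intro f g
    refine Integrable.of_bound (((hG.measurable_homIndicator a b _).sub_const t).mul
      ((hG.measurable_homIndicator a b _).sub_const t)).aestronglyMeasurable 1 ?_
    refine Eventually.of_forall fun ω => ?_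
    have hb : ∀ f, |c f ω| ≤ 1 := fun f => by
      have h0 := homIndicator_nonneg a b (G ω) (fun v => (f v : ℕ))
      have h1 := homIndicator_le_one a b (G ω) (fun v => (f v : ℕ))
      rw [abs_le]
      constructor <;> linarith [ht01.1, ht01.2]
    rw [Real.norm_eq_abs, abs_mul]
    exact mul_le_one₀ (hb f) (abs_nonneg _) (hb g)
  have hcle : ∀ f g, ∫ ω, c f ω * c g ω ∂P ≤ 1 := by
    intro f g
    have : ∫ ω, c f ω * c g ω ∂P ≤ ∫ _, (1 : ℝ) ∂P := by
      refine integral_mono (hcint f g) (integrable_const _) fun ω => ?_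
      have h0 := homIndicator_nonneg a b (G ω) (fun v => (f v : ℕ))
      have h1 := homIndicator_le_one a b (G ω) (fun v => (f v : ℕ))
      have h2 := homIndicator_nonneg a b (G ω) (fun v => (g v : ℕ))
      have h3 := homIndicator_le_one a b (G ω) (fun v => (g v : ℕ))
      have hf1 : |c f ω| ≤ 1 := abs_le.2 ⟨by linarith [ht01.1, ht01.2], by linarith [ht01.1]⟩
      have hg1 : |c g ω| ≤ 1 := abs_le.2 ⟨by linarith [ht01.1, ht01.2], by linarith [ht01.1]⟩
      exact (le_abs_self _).trans (by rw [abs_mul]; exact mul_le_one₀ hf1 (abs_nonneg _) hg1)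
    simpa using this
  have hdev : ∀ ω, homDensity a b (G ω) n - t
      = (∑ f, c f ω) / (n : ℝ) ^ Fintype.card V := by
    intro ω
    simp only [c, homDensity, Finset.sum_sub_distrib, Finset.sum_const, Finset.card_univ,
      Fintype.card_fun, Fintype.card_fin, nsmul_eq_mul, Nat.cast_pow]
    field_simp
  have hsq : ∀ ω, (homDensity a b (G ω) n - t) ^ 2
      = (∑ h : V ⊕ V → Fin n, c (h ∘ Sum.inl) ω * c (h ∘ Sum.inr) ω)
        / (n : ℝ) ^ Fintype.card (V ⊕ V) := by
    intro ω
    rw [hdev, div_pow, sq (∑ f, c f ω), Finset.sum_mul_sum, ← Fintype.sum_prod_type',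
      ← (Equiv.sumArrowEquivProdArrow V V (Fin n)).sum_comp, Fintype.card_sum, ← two_mul,
      ← pow_mul, mul_comm 2]
    rfl
  simp only [hsq]
  rw [integral_div, integral_finsetSum _ fun h _ => hcint _ _]
  have hterm : ∀ h : V ⊕ V → Fin n, ∫ ω, c (h ∘ Sum.inl) ω * c (h ∘ Sum.inr) ω ∂P
      ≤ if ¬ Function.Injective h then 1 else 0 := by
    intro h
    split_ifs with hh
    · exact (hG.integral_homIndicator_sub_mul hab hinj
        (f := fun v => (h (Sum.inl v) : ℕ)) (g := fun v => (h (Sum.inr v) : ℕ)) (by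
          have : Sum.elim (fun v => (h (Sum.inl v) : ℕ)) (fun v => (h (Sum.inr v) : ℕ))
              = fun v => (h v : ℕ) := by ext (v | v) <;> rfl
          rw [this]
          exact Fin.val_injective.comp hh)).le
    · exact hcle _ _
  have hcount := card_filter_not_injective_le (V ⊕ V) n hn
  rw [div_le_iff₀ (by positivity)]
  refine (Finset.sum_le_sum fun h _ => hterm h).trans ?_
  rw [Finset.sum_boole]
  refine hcount.trans (le_of_eq ?_)
  simp [two_mul]

theorem IsWRandomGraph.ae_tendsto_homDensity (hG : IsWRandomGraph W P X G) {ι V : Type*}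
    [Fintype ι] [Fintype V] [DecidableEq V] {a b : ι → V} (hab : ∀ i, a i ≠ b i)
    (hinj : Function.Injective fun i => s(a i, b i)) :
    ∀ᵐ ω ∂P, Tendsto (homDensity a b (G ω)) atTop (𝓝 (graphonDensity a b W)) := by
  set t := graphonDensity a b W with ht
  have ht01 := graphonDensity_mem a b W
  -- The variance bound `O(1/n)` is summable only along a subsequence such as the squares; the shift
  -- by one avoids `n = 0`.
  let Y : ℕ → Ω → ℝ := fun j ω => (homDensity a b (G ω) ((j + 1) ^ 2) - t) ^ 2
  have hY0 : ∀ j ω, 0 ≤ Y j ω := fun j ω => sq_nonneg _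
  have hYm : ∀ j, Measurable (Y j) := fun j =>
    ((hG.measurable_homDensity a b _).sub_const t).pow_const 2
  have hYi : ∀ j, Integrable (Y j) P := fun j =>
    Integrable.of_bound (hYm j).aestronglyMeasurable 1 (Eventually.of_forall fun ω => by
      have h := homDensity_mem a b (G ω) ((j + 1) ^ 2)
      rw [Real.norm_of_nonneg (hY0 j ω)]
      refine (sq_le_one_iff_abs_le_one _).2 (abs_le.2 ⟨?_, ?_⟩) <;>
        linarith [h.1, h.2, ht01.1, ht01.2])
  have hsum : Summable fun j => ∫ ω, Y j ω ∂P := by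
    refine Summable.of_nonneg_of_le (fun j => integral_nonneg (hY0 j))
      (fun j => hG.integral_homDensity_sub_sq_le hab hinj (n := (j + 1) ^ 2) (by positivity)) ?_
    have h2 : Summable fun j : ℕ => 1 / ((j + 1 : ℕ) : ℝ) ^ 2 :=
      (summable_nat_add_iff 1).2 (Real.summable_one_div_nat_pow.2 one_lt_two)
    refine (h2.mul_left ((2 * Fintype.card V : ℝ) ^ 2)).congr fun j => ?_
    push_cast
    ring
  -- The sum of the squared errors has finite expectation, hence is almost surely finite, so its
  -- terms tend to zero.
  have hfin : ∫⁻ ω, ∑' j, ENNReal.ofReal (Y j ω) ∂P ≠ ∞ := by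
    rw [lintegral_tsum fun j => (hYm j).ennreal_ofReal.aemeasurable]
    simp only [← ofReal_integral_eq_lintegral_ofReal (hYi _) (Eventually.of_forall (hY0 _))]
    exact hsum.tsum_ofReal_ne_top
  have hae := ae_lt_top (Measurable.tsum fun j => (hYm j).ennreal_ofReal) hfin
  filter_upwards [hae] with ω hω
  have hs : Tendsto (fun j => ENNReal.ofReal (Y j ω)) atTop (𝓝 0) :=
    ENNReal.tendsto_atTop_zero_of_tsum_ne_top hω.ne
  have hY : Tendsto (fun j => Y j ω) atTop (𝓝 0) := by
    have := (ENNReal.tendsto_toReal ENNReal.zero_ne_top).comp hs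
    simpa [Function.comp_def, ENNReal.toReal_ofReal (hY0 _ _)] using this
  have habs : Tendsto (fun j => |homDensity a b (G ω) ((j + 1) ^ 2) - t|) atTop (𝓝 0) := by
    have := (Real.continuous_sqrt.tendsto 0).comp hY
    simpa [Function.comp_def, Y, Real.sqrt_sq_eq_abs] using this
  have hsub : Tendsto (fun j => homDensity a b (G ω) ((j + 1) ^ 2)) atTop (𝓝 t) := by
    rw [← tendsto_sub_nhds_zero_iff]
    exact (tendsto_zero_iff_abs_tendsto_zero _).2 habs
  exact tendsto_div_pow_of_tendsto_sq
    (fun n => ∑ f : V → Fin n, homIndicator a b (G ω) (fun v => (f v : ℕ)))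
    (fun m n hmn => homCount_mono a b (G ω) hmn)
    (fun n => Finset.sum_nonneg fun _ _ => homIndicator_nonneg _ _ _ _) _ t hsub

end Random

/-! ### Gluing partially labeled graphs along their labeled vertices -/

section Glue

variable {p k : ℕ} {R : Type*}

/-- The embedding of the `s`-th copy of `[p]` in the vertex set of the glued graph: the labeled
vertices are common to all copies. -/
noncomputable def glueMap (ℓ : Fin k ↪ Fin p) (s : R) : Fin p → Fin k ⊕ R × Fin p :=
  Function.extend ℓ Sum.inl fun i => Sum.inr (s, i)

theorem glueMap_label (ℓ : Fin k ↪ Fin p) (s : R) (i : Fin k) :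
    glueMap ℓ s (ℓ i) = Sum.inl i :=
  ℓ.injective.extend_apply _ _ _

theorem glueMap_of_notMem (ℓ : Fin k ↪ Fin p) (s : R) {i : Fin p} (hi : i ∉ Set.range ℓ) :
    glueMap ℓ s i = Sum.inr (s, i) :=
  Function.extend_apply' _ _ _ hi

theorem glueMap_eq_inl_iff (ℓ : Fin k ↪ Fin p) (s : R) (i : Fin p) (j : Fin k) :
    glueMap ℓ s i = Sum.inl j ↔ i = ℓ j := by
  by_cases hi : i ∈ Set.range ℓ
  · obtain ⟨j', rfl⟩ := hi
    simp [glueMap_label]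
  · rw [glueMap_of_notMem ℓ s hi]
    simp only [reduceCtorEq, false_iff]
    rintro rfl
    exact hi ⟨j, rfl⟩

theorem glueMap_eq_inr (ℓ : Fin k ↪ Fin p) {s s' : R} {i j : Fin p}
    (h : glueMap ℓ s i = Sum.inr (s', j)) : s = s' ∧ i = j := by
  by_cases hi : i ∈ Set.range ℓ
  · obtain ⟨j', rfl⟩ := hi
    simp [glueMap_label] at h
  · rw [glueMap_of_notMem ℓ s hi] at h
    simpa using h

theorem glueMap_injective (ℓ : Fin k ↪ Fin p) (s : R) :
    Function.Injective (glueMap (R := R) ℓ s) := by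
  intro i j h
  by_cases hj : j ∈ Set.range ℓ
  · obtain ⟨j', rfl⟩ := hj
    rw [glueMap_label] at h
    exact (glueMap_eq_inl_iff ℓ s i j').1 h
  · rw [glueMap_of_notMem ℓ s hj] at h
    exact (glueMap_eq_inr ℓ h).2

/-- The vertices `Sum.inr (s, ℓ i)` lie in no glued copy. These isolated vertices do not change
densities and keep the vertex set a plain sum and product, matching the unused coordinates of `z` in
`tTilde`. -/
theorem comp_glueMap {A : Type*} (ℓ : Fin k ↪ Fin p) (s : R) (f : Fin k ⊕ R × Fin p → A) :
    (fun i => f (glueMap ℓ s i))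
      = Function.extend ℓ (fun i => f (Sum.inl i)) fun i => f (Sum.inr (s, i)) := by
  funext i
  exact Function.apply_extend f _ _ i

/-- The edges of the glued graph: the labeled edges of `F₀`, and one copy of the other edges of
each `F s`. -/
abbrev GlueEdge (F₀ : SimpleGraph (Fin p)) (F : R → SimpleGraph (Fin p)) (ℓ : Fin k ↪ Fin p) :
    Type _ :=
  {e : Fin k × Fin k // e.1 < e.2 ∧ F₀.Adj (ℓ e.1) (ℓ e.2)} ⊕
    Σ s : R, {e : Fin p × Fin p //
      e.1 < e.2 ∧ (F s).Adj e.1 e.2 ∧ ¬(e.1 ∈ Set.range ℓ ∧ e.2 ∈ Set.range ℓ)}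

/-- The smaller endpoint of an edge of the glued graph. -/
noncomputable def glueFst (F₀ : SimpleGraph (Fin p)) (F : R → SimpleGraph (Fin p))
    (ℓ : Fin k ↪ Fin p) : GlueEdge F₀ F ℓ → Fin k ⊕ R × Fin p :=
  Sum.elim (fun e => Sum.inl e.1.1) fun e => glueMap ℓ e.1 e.2.1.1

/-- The larger endpoint of an edge of the glued graph. -/
noncomputable def glueSnd (F₀ : SimpleGraph (Fin p)) (F : R → SimpleGraph (Fin p))
    (ℓ : Fin k ↪ Fin p) : GlueEdge F₀ F ℓ → Fin k ⊕ R × Fin p :=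
  Sum.elim (fun e => Sum.inl e.1.2) fun e => glueMap ℓ e.1 e.2.1.2

variable (F₀ : SimpleGraph (Fin p)) (F : R → SimpleGraph (Fin p)) (ℓ : Fin k ↪ Fin p)

theorem glueFst_ne_glueSnd (e : GlueEdge F₀ F ℓ) : glueFst F₀ F ℓ e ≠ glueSnd F₀ F ℓ e := by
  rcases e with e | ⟨s, e⟩
  · exact fun h => e.2.1.ne (Sum.inl_injective h)
  · exact fun h => e.2.1.ne (glueMap_injective ℓ s h)

theorem sym2_mk_inj_of_lt {A : Type*} [LinearOrder A] {a b c d : A} (hab : a < b) (hcd : c < d)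
    (h : s(a, b) = s(c, d)) : (a, b) = (c, d) := by
  rcases Sym2.eq_iff.1 h with ⟨rfl, rfl⟩ | ⟨rfl, rfl⟩
  · rfl
  · exact absurd hcd hab.not_gt

theorem exists_glueMap_eq_inr (s : R) {e : Fin p × Fin p}
    (he : ¬(e.1 ∈ Set.range ℓ ∧ e.2 ∈ Set.range ℓ)) :
    ∃ i, Sum.inr (s, i) ∈ s(glueMap ℓ s e.1, glueMap ℓ s e.2) := by
  by_cases h1 : e.1 ∈ Set.range ℓ
  · have h2 : e.2 ∉ Set.range ℓ := fun h2 => he ⟨h1, h2⟩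
    exact ⟨e.2, by rw [glueMap_of_notMem ℓ s h2]; exact Sym2.mem_mk_right _ _⟩
  · exact ⟨e.1, by rw [glueMap_of_notMem ℓ s h1]; exact Sym2.mem_mk_left _ _⟩

/-- The glued graph has no multiple edges: an edge that is not between two labels has an endpoint
`Sum.inr (s, i)`, which reveals its copy `s`. Without this, a repeated edge would count once in the
random graph but twice in the integral of `W`. -/
theorem glue_edges_injective :
    Function.Injective fun e => s(glueFst F₀ F ℓ e, glueSnd F₀ F ℓ e) := by
  have hmixed : ∀ (e : {e : Fin k × Fin k // e.1 < e.2 ∧ F₀.Adj (ℓ e.1) (ℓ e.2)}) (s : R)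
      (e' : {e : Fin p × Fin p //
        e.1 < e.2 ∧ (F s).Adj e.1 e.2 ∧ ¬(e.1 ∈ Set.range ℓ ∧ e.2 ∈ Set.range ℓ)}),
      s((Sum.inl e.1.1 : Fin k ⊕ R × Fin p), Sum.inl e.1.2)
        ≠ s(glueMap ℓ s e'.1.1, glueMap ℓ s e'.1.2) := by
    intro e s e' h
    obtain ⟨i, hi⟩ := exists_glueMap_eq_inr ℓ s e'.2.2.2
    rw [← h] at hi
    simp at hi
  rintro (e | ⟨s, e⟩) (e' | ⟨s', e'⟩) h
  · have h' : s(e.1.1, e.1.2) = s(e'.1.1, e'.1.2) :=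
      Sym2.map.injective (f := (Sum.inl : Fin k → Fin k ⊕ R × Fin p)) Sum.inl_injective h
    exact congrArg Sum.inl (Subtype.ext (sym2_mk_inj_of_lt e.2.1 e'.2.1 h'))
  · exact absurd h (hmixed e s' e')
  · exact absurd h.symm (hmixed e' s e)
  · simp only [glueFst, glueSnd, Sum.elim_inr] at h
    obtain ⟨i, hi⟩ := exists_glueMap_eq_inr ℓ s e.2.2.2
    rw [h, Sym2.mem_iff] at hi
    have hs : s' = s := by
      rcases hi with hi | hi
      · exact (glueMap_eq_inr ℓ hi.symm).1
      · exact (glueMap_eq_inr ℓ hi.symm).1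
    subst hs
    have h' : s(e.1.1, e.1.2) = s(e'.1.1, e'.1.2) :=
      Sym2.map.injective (glueMap_injective ℓ s') h
    have := Subtype.ext (sym2_mk_inj_of_lt e.2.1 e'.2.1 h')
    rw [this]

/-- The indicator that `f` is a homomorphism from `F` to `G`. -/
noncomputable def graphHomIndicator {V U : Type*} (F : SimpleGraph V) (G : SimpleGraph U)
    (f : V → U) : ℝ :=
  Set.indicator {f | ∀ i j, F.Adj i j → G.Adj (f i) (f j)} 1 f

theorem graphHomIndicator_nonneg {V U : Type*} (F : SimpleGraph V) (G : SimpleGraph U)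
    (f : V → U) : 0 ≤ graphHomIndicator F G f :=
  Set.indicator_nonneg (fun _ _ => zero_le_one) _

theorem graphHomIndicator_le_one {V U : Type*} (F : SimpleGraph V) (G : SimpleGraph U)
    (f : V → U) : graphHomIndicator F G f ≤ 1 :=
  Set.indicator_le_self' (fun _ _ => zero_le_one) _

variable {F₀ F ℓ}

/-- A map is a homomorphism from the glued graph iff it is one from each of the glued copies. -/
theorem homIndicator_glue [Fintype R] [Nonempty R] {U : Type*} (G : SimpleGraph U)
    (hF : ∀ s i j, (F s).Adj (ℓ i) (ℓ j) ↔ F₀.Adj (ℓ i) (ℓ j)) (f : Fin k ⊕ R × Fin p → U) :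
    homIndicator (glueFst F₀ F ℓ) (glueSnd F₀ F ℓ) G f
      = ∏ s, graphHomIndicator (F s) G fun i => f (glueMap ℓ s i) := by
  classical
  have hiff : (∀ e, G.Adj (f (glueFst F₀ F ℓ e)) (f (glueSnd F₀ F ℓ e)))
      ↔ ∀ s i j, (F s).Adj i j → G.Adj (f (glueMap ℓ s i)) (f (glueMap ℓ s j)) := by
    constructor
    · intro h s
      have hlt : ∀ i j, i < j → (F s).Adj i j → G.Adj (f (glueMap ℓ s i)) (f (glueMap ℓ s j)) := by
        intro i j hij hadj
        by_cases hl : i ∈ Set.range ℓ ∧ j ∈ Set.range ℓ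
        · obtain ⟨⟨i, rfl⟩, ⟨j, rfl⟩⟩ := hl
          rw [hF] at hadj
          rw [glueMap_label, glueMap_label]
          rcases lt_or_gt_of_ne (fun h : i = j => hij.ne (congrArg ℓ h)) with h' | h'
          · exact h (Sum.inl ⟨(i, j), h', hadj⟩)
          · exact (h (Sum.inl ⟨(j, i), h', hadj.symm⟩)).symm
        · exact h (Sum.inr ⟨s, ⟨(i, j), hij, hadj, hl⟩⟩)
      intro i j hadj
      rcases lt_or_gt_of_ne hadj.ne with hij | hij
      · exact hlt i j hij hadj
      · exact (hlt j i hij hadj.symm).symm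
    · rintro h (e | ⟨s, e⟩)
      -- At least one copy is needed here: with none, nothing would enforce the labeled edges of
      -- `F₀`.
      · obtain ⟨s⟩ := ‹Nonempty R›
        have := h s _ _ ((hF s _ _).2 e.2.2)
        rwa [glueMap_label, glueMap_label] at this
      · exact h s _ _ e.2.2.1
  simp only [homIndicator, graphHomIndicator, Set.indicator, Set.mem_ofPred_eq, Pi.one_apply, hiff,
    Fintype.prod_boole]

/-- The proportion of maps `z` such that `z`, with its values at the labels replaced by `β`, is a
homomorphism from `F` to `G`. -/
noncomputable def rootedHomDensity {n : ℕ} (F : SimpleGraph (Fin p)) (ℓ : Fin k ↪ Fin p)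
    (G : SimpleGraph (Fin n)) (β : Fin k → Fin n) : ℝ :=
  (∑ z : Fin p → Fin n, graphHomIndicator F G (Function.extend ℓ β z)) / (n : ℝ) ^ p

theorem rootedHomDensity_mem {n : ℕ} (F : SimpleGraph (Fin p)) (ℓ : Fin k ↪ Fin p)
    (G : SimpleGraph (Fin n)) (β : Fin k → Fin n) :
    rootedHomDensity F ℓ G β ∈ Set.Icc (0 : ℝ) 1 := by
  refine ⟨div_nonneg (Finset.sum_nonneg fun _ _ => graphHomIndicator_nonneg _ _ _) (by positivity),
    div_le_one_of_le₀ ?_ (by positivity)⟩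
  refine (Finset.sum_le_sum fun _ _ => graphHomIndicator_le_one _ _ _).trans ?_
  simp

theorem graphHomIndicator_restrictGraph {V : Type*} (F : SimpleGraph V) (G : SimpleGraph ℕ)
    (n : ℕ) (f : V → Fin n) :
    graphHomIndicator F (restrictGraph G n) f = graphHomIndicator F G fun v => (f v : ℕ) := by
  classical
  simp [graphHomIndicator, Set.indicator, restrictGraph]

/-- Once the images `β` of the labels are fixed, the copies share no further vertex, so the sum over
the remaining images factors over `s`. -/
theorem homDensity_glue [Fintype R] [DecidableEq R] [Nonempty R] (G : SimpleGraph ℕ)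
    (hF : ∀ s i j, (F s).Adj (ℓ i) (ℓ j) ↔ F₀.Adj (ℓ i) (ℓ j)) (n : ℕ) :
    homDensity (glueFst F₀ F ℓ) (glueSnd F₀ F ℓ) G n
      = (∑ β : Fin k → Fin n, ∏ s, rootedHomDensity (F s) ℓ (restrictGraph G n) β)
        / (n : ℝ) ^ k := by
  classical
  let e : (Fin k ⊕ R × Fin p → Fin n) ≃ (Fin k → Fin n) × (R → Fin p → Fin n) :=
    (Equiv.sumArrowEquivProdArrow _ _ _).trans
      (Equiv.prodCongr (Equiv.refl _) (Equiv.curry R (Fin p) (Fin n)))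
  have hterm : ∀ f : Fin k ⊕ R × Fin p → Fin n,
      homIndicator (glueFst F₀ F ℓ) (glueSnd F₀ F ℓ) G (fun v => (f v : ℕ))
        = ∏ s, graphHomIndicator (F s) (restrictGraph G n)
          (Function.extend ℓ (e f).1 ((e f).2 s)) := by
    intro f
    rw [homIndicator_glue G hF fun v => (f v : ℕ)]
    refine Finset.prod_congr rfl fun s _ => ?_
    rw [← graphHomIndicator_restrictGraph (F s) G n fun i => f (glueMap ℓ s i), comp_glueMap]
    rfl
  rw [homDensity]
  simp only [hterm]
  rw [e.sum_comp fun q => ∏ s, graphHomIndicator (F s) (restrictGraph G n)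
    (Function.extend ℓ q.1 (q.2 s)), Fintype.sum_prod_type]
  simp only [rootedHomDensity, Finset.prod_div_distrib, Finset.prod_const, Finset.card_univ,
    Finset.prod_univ_sum, Fintype.piFinset_univ]
  rw [← Finset.sum_div, div_div, ← pow_mul, ← pow_add]
  simp only [Fintype.card_sum, Fintype.card_prod, Fintype.card_fin]
  rw [show k + Fintype.card R * p = p * Fintype.card R + k by ring]

open Classical in
-- The continuous analogue of `homDensity_glue`: by Fubini, with the label coordinates `x` fixed,
-- the integral over the other coordinates is a product over the copies.
theorem graphonDensity_glue [Fintype R] (W : Graphon) :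
    graphonDensity (glueFst F₀ F ℓ) (glueSnd F₀ F ℓ) W
      = ∫ x : Fin k → I, tHat W F₀ ℓ x * ∏ s, tTilde W (F s) ℓ x := by
  set φ : (Fin k ⊕ R × Fin p → I) → ℝ :=
    fun y => ∏ i, W (y (glueFst F₀ F ℓ i)) (y (glueSnd F₀ F ℓ i)) with hφ
  have hφi : Integrable φ := Integrable.of_bound
    (measurable_prod_graphon W _ _).aestronglyMeasurable 1 (Eventually.of_forall fun y => by
      have h := prod_graphon_mem W Finset.univ (fun i => y (glueFst F₀ F ℓ i))
        (fun i => y (glueSnd F₀ F ℓ i))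
      rw [Real.norm_of_nonneg h.1]
      exact h.2)
  have hφsplit : ∀ y, φ y = tHat W F₀ ℓ (fun i => y (Sum.inl i)) * ∏ s, zTilde W (F s) ℓ
      (Function.extend ℓ (fun i => y (Sum.inl i)) fun i => y (Sum.inr (s, i))) := by
    intro y
    simp only [hφ, Fintype.prod_sum_type, Fintype.prod_sigma, glueFst, glueSnd, Sum.elim_inl,
      Sum.elim_inr]
    congr 1
    · rw [tHat, ← Finset.prod_subtype_eq_prod_filter, Finset.subtype_univ]
    · refine Finset.prod_congr rfl fun s _ => ?_
      rw [← comp_glueMap, zTilde, ← Finset.prod_subtype_eq_prod_filter, Finset.subtype_univ]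
  have hmp := (volume_measurePreserving_sumPiEquivProdPi (fun _ : Fin k ⊕ R × Fin p => I)).symm
  -- Currying is measure preserving for infinite products, which coincide with finite products over
  -- finite index types.
  have hcurry : MeasurePreserving (MeasurableEquiv.curry R (Fin p) I) volume volume := by
    refine ⟨(MeasurableEquiv.curry R (Fin p) I).measurable, ?_⟩
    have h := Measure.infinitePi_map_curry (fun (_ : R) (_ : Fin p) => (volume : Measure I))
    simp only [Measure.infinitePi_eq_pi] at h
    exact h
  have hint : Integrable (fun q => φ ((MeasurableEquiv.sumPiEquivProdPi
      fun _ : Fin k ⊕ R × Fin p => I).symm q)) (volume.prod volume) :=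
    (hmp.integrable_comp_emb (MeasurableEquiv.measurableEmbedding _)).2 hφi
  change ∫ y, φ y = _
  rw [← hmp.integral_comp', Measure.volume_eq_prod, integral_prod _ hint]
  refine integral_congr_ae (Eventually.of_forall fun x => ?_)
  have hinner := hcurry.integral_comp' fun z : R → Fin p → I =>
    tHat W F₀ ℓ x * ∏ s, zTilde W (F s) ℓ (Function.extend ℓ x (z s))
  refine (Eq.trans (integral_congr_ae (Eventually.of_forall fun w => ?_)) hinner).trans ?_
  · exact hφsplit _
  · rw [integral_const_mul, integral_fintype_prod_volume_eq_prod
      (fun s (z : Fin p → I) => zTilde W (F s) ℓ (Function.extend ℓ x z))]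
    rfl

end Glue

/-! ### Injective homomorphism densities versus homomorphism densities -/

section Compare

variable {p k n : ℕ}

theorem extend_extend_right {A : Type*} (ℓ : Fin k ↪ Fin p) (a b : Fin k → A) (z : Fin p → A) :
    Function.extend ℓ a (Function.extend ℓ b z) = Function.extend ℓ a z := by
  funext i
  by_cases hi : ∃ j, ℓ j = i
  · obtain ⟨j, rfl⟩ := hi
    simp only [ℓ.injective.extend_apply]
  · simp only [Function.extend_apply' _ _ _ hi]

theorem extend_comp_self {A : Type*} (ℓ : Fin k ↪ Fin p) (z : Fin p → A) :
    Function.extend ℓ (fun j => z (ℓ j)) z = z := by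
  funext i
  by_cases hi : ∃ j, ℓ j = i
  · obtain ⟨j, rfl⟩ := hi
    simp only [ℓ.injective.extend_apply]
  · simp only [Function.extend_apply' _ _ _ hi]

/-- A word whose values at the labels are replaced by `α` is an injective homomorphism respecting
the labels, together with the values which have been replaced. -/
noncomputable def labeledInjEquiv (F : SimpleGraph (Fin p)) (ℓ : Fin k ↪ Fin p)
    (G : SimpleGraph (Fin n)) (α : Fin k ↪ Fin n) :
    {z : Fin p → Fin n // Function.Injective (Function.extend ℓ α z) ∧
      ∀ i j, F.Adj i j → G.Adj (Function.extend ℓ α z i) (Function.extend ℓ α z j)}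
      ≃ labeledInj F ℓ G α × (Fin k → Fin n) where
  toFun z := (⟨⟨Function.extend ℓ α z.1, z.2.1⟩, z.2.2,
    fun i => ℓ.injective.extend_apply _ _ i⟩, fun j => z.1 (ℓ j))
  invFun q := ⟨Function.extend ℓ q.2 q.1.1, by
    have h : Function.extend ℓ α (Function.extend ℓ q.2 q.1.1) = q.1.1 := by
      rw [extend_extend_right, ← funext q.1.2.2, extend_comp_self]
    rw [h]
    exact ⟨q.1.1.injective, q.1.2.1⟩⟩
  left_inv z := by
    refine Subtype.ext ?_
    simp only [Function.Embedding.coeFn_mk]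
    rw [extend_extend_right, extend_comp_self]
  right_inv q := by
    refine Prod.ext (Subtype.ext (DFunLike.coe_injective ?_)) ?_
    · simp only [Function.Embedding.coeFn_mk]
      rw [extend_extend_right, ← funext q.1.2.2, extend_comp_self]
    · funext j
      exact ℓ.injective.extend_apply _ _ j

open Classical in
theorem sum_graphHomIndicator_injective (F : SimpleGraph (Fin p)) (ℓ : Fin k ↪ Fin p)
    (G : SimpleGraph (Fin n)) (α : Fin k ↪ Fin n) :
    ∑ z : Fin p → Fin n with Function.Injective (Function.extend ℓ α z),
        graphHomIndicator F G (Function.extend ℓ α z)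
      = (labeledInj F ℓ G α).ncard * (n : ℝ) ^ k := by
  have h := Nat.card_congr (labeledInjEquiv F ℓ G α)
  rw [Nat.card_prod, Nat.card_coe_set_eq, Nat.card_fun, Nat.card_fin, Nat.card_fin,
    Nat.card_eq_fintype_card, Fintype.card_subtype] at h
  simp only [graphHomIndicator, Set.indicator, Set.mem_ofPred_eq, Pi.one_apply]
  rw [Finset.sum_boole, Finset.filter_filter, h]
  push_cast
  rfl

/-- Each fibre of `f ↦ ℓ.trans f` has at most this size by `labeledInj_ncard_le`. The fibres
partition all embeddings, whose number equals the sum of the bounds, so every bound is attained. -/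
theorem labeledInj_bot_ncard (ℓ : Fin k ↪ Fin p) (G : SimpleGraph (Fin n))
    (α : Fin k ↪ Fin n) :
    (labeledInj (⊥ : SimpleGraph (Fin p)) ℓ G α).ncard = (n - k).descFactorial (p - k) := by
  classical
  have hkp : k ≤ p := by simpa using Fintype.card_le_of_embedding ℓ
  have hfib : ∀ β : Fin k ↪ Fin n, (labeledInj (⊥ : SimpleGraph (Fin p)) ℓ G β).ncard
      = (Finset.univ.filter fun f : Fin p ↪ Fin n => ℓ.trans f = β).card := by
    intro β
    rw [← Set.ncard_coe_finset]
    congr 1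
    ext f
    simp [labeledInj, DFunLike.ext_iff]
  have hsum : ∑ β : Fin k ↪ Fin n, (labeledInj (⊥ : SimpleGraph (Fin p)) ℓ G β).ncard
      = ∑ _β : Fin k ↪ Fin n, (n - k).descFactorial (p - k) := by
    simp only [hfib]
    rw [← Finset.card_eq_sum_card_fiberwise (fun _ _ => Finset.mem_coe.2 (Finset.mem_univ _)),
      Finset.sum_const, Finset.card_univ, Finset.card_univ, Fintype.card_embedding_eq,
      Fintype.card_embedding_eq, Fintype.card_fin, Fintype.card_fin, Fintype.card_fin,
      smul_eq_mul, mul_comm, Nat.descFactorial_mul_descFactorial hkp]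
  exact (Finset.sum_eq_sum_iff_of_le fun β _ => labeledInj_ncard_le _ ℓ G β).1 hsum α
    (Finset.mem_univ _)

/-- Both densities average the same indicator: one over all `z`, the other over the `z` whose
relabeling by `α` is injective. The overwritten label values give a common factor `n ^ k`, which
cancels. -/
theorem abs_labeledInjDensity_sub_rootedHomDensity_le (F : SimpleGraph (Fin p))
    (ℓ : Fin k ↪ Fin p) (hpn : p ≤ n) (hn : 0 < n) (G : SimpleGraph (Fin n)) (α : Fin k ↪ Fin n) :
    |labeledInjDensity F ℓ G α - rootedHomDensity F ℓ G α| ≤ (p : ℝ) ^ 2 / n := by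
  classical
  have hkp : k ≤ p := by simpa using Fintype.card_le_of_embedding ℓ
  have hn' : (0 : ℝ) < n := by exact_mod_cast hn
  set B := Finset.univ.filter fun z : Fin p → Fin n =>
    Function.Injective (Function.extend ℓ α z) with hB
  have hBcard : (B.card : ℝ) = ((n - k).descFactorial (p - k) : ℝ) * (n : ℝ) ^ k := by
    rw [← labeledInj_bot_ncard ℓ G α, ← sum_graphHomIndicator_injective]
    simp [graphHomIndicator, Set.indicator, hB]
  have hpos : (0 : ℝ) < ((n - k).descFactorial (p - k) : ℝ) := by
    exact_mod_cast Nat.descFactorial_pos.2 (by omega)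
  have hBpos : (0 : ℝ) < B.card := by rw [hBcard]; positivity
  have h := abs_average_subset_sub_average_le B
    (fun z => graphHomIndicator F G (Function.extend ℓ α z))
    (fun _ => graphHomIndicator_nonneg _ _ _) (fun _ => graphHomIndicator_le_one _ _ _)
    (Finset.card_pos.1 (by exact_mod_cast hBpos))
  have hcard : (Fintype.card (Fin p → Fin n) : ℝ) = (n : ℝ) ^ p := by simp
  rw [hcard, hBcard, hB, sum_graphHomIndicator_injective,
    mul_div_mul_right _ _ (by positivity)] at h
  refine h.trans ?_
  have hq := one_sub_sq_div_le_descFactorial_div_pow n p hn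
  have hle : (n.descFactorial p : ℝ) ≤ ((n - k).descFactorial (p - k) : ℝ) * (n : ℝ) ^ k := by
    rw [← Nat.descFactorial_mul_descFactorial hkp]
    push_cast
    gcongr
    exact_mod_cast Nat.descFactorial_le_pow n k
  have := div_le_div_of_nonneg_right hle (by positivity : (0 : ℝ) ≤ (n : ℝ) ^ p)
  linarith

theorem sum_injective_eq_sum_embedding {A : Type*} [AddCommMonoid A]
    [DecidablePred (Function.Injective : (Fin k → Fin n) → Prop)] (c : (Fin k → Fin n) → A) :
    ∑ β : Fin k → Fin n with Function.Injective β, c β = ∑ α : Fin k ↪ Fin n, c α := by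
  rw [← Finset.sum_subtype_eq_sum_filter, Finset.subtype_univ]
  exact (Equiv.subtypeInjectiveEquivEmbedding (Fin k) (Fin n)).sum_comp fun α => c α

/-- The mixed moments of the empirical measure are close to homomorphism densities of glued
graphs. -/
theorem abs_average_prod_labeledInjDensity_sub_homDensity_le {R : Type*} [Fintype R]
    [DecidableEq R] [Nonempty R] {F₀ : SimpleGraph (Fin p)} {F : R → SimpleGraph (Fin p)}
    {ℓ : Fin k ↪ Fin p} (hF : ∀ s i j, (F s).Adj (ℓ i) (ℓ j) ↔ F₀.Adj (ℓ i) (ℓ j))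
    (G : SimpleGraph ℕ) (hpn : p ≤ n) (hn : 0 < n) :
    |(∑ α : Fin k ↪ Fin n, ∏ s, labeledInjDensity (F s) ℓ (restrictGraph G n) α)
        / n.descFactorial k - homDensity (glueFst F₀ F ℓ) (glueSnd F₀ F ℓ) G n|
      ≤ (Fintype.card R * (p : ℝ) ^ 2 + (k : ℝ) ^ 2) / n := by
  classical
  have hkp : k ≤ p := by simpa using Fintype.card_le_of_embedding ℓ
  have hD : (0 : ℝ) < n.descFactorial k := by
    exact_mod_cast Nat.descFactorial_pos.2 (hkp.trans hpn)
  set H := restrictGraph G n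
  let c : (Fin k → Fin n) → ℝ := fun β => ∏ s, rootedHomDensity (F s) ℓ H β
  have hBcard : (Finset.univ.filter (Function.Injective : (Fin k → Fin n) → Prop)).card
      = n.descFactorial k := by
    rw [card_filter_injective, Fintype.card_fin]
  -- Two separate errors: `h1` drops injectivity of the word of labels, and `h2` drops injectivity
  -- inside each of the `Fintype.card R` factors.
  have h1 : |(∑ α : Fin k ↪ Fin n, c α) / n.descFactorial k - (∑ β, c β) / (n : ℝ) ^ k|
      ≤ (k : ℝ) ^ 2 / n := by
    have h := abs_average_subset_sub_average_le
      (Finset.univ.filter (Function.Injective : (Fin k → Fin n) → Prop)) c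
      (fun β => Finset.prod_nonneg fun s _ => (rootedHomDensity_mem (F s) ℓ H β).1)
      (fun β => Finset.prod_le_one (fun s _ => (rootedHomDensity_mem (F s) ℓ H β).1)
        fun s _ => (rootedHomDensity_mem (F s) ℓ H β).2)
      (Finset.card_pos.1 (by rw [hBcard]; exact_mod_cast hD))
    have hcard : (Fintype.card (Fin k → Fin n) : ℝ) = (n : ℝ) ^ k := by simp
    rw [hBcard, sum_injective_eq_sum_embedding, hcard] at h
    linarith [one_sub_sq_div_le_descFactorial_div_pow n k hn]
  have h2 : |(∑ α : Fin k ↪ Fin n, ∏ s, labeledInjDensity (F s) ℓ H α) / n.descFactorial k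
      - (∑ α : Fin k ↪ Fin n, c α) / n.descFactorial k| ≤ Fintype.card R * ((p : ℝ) ^ 2 / n) := by
    rw [← sub_div, ← Finset.sum_sub_distrib, abs_div, abs_of_pos hD, div_le_iff₀ hD]
    refine (Finset.abs_sum_le_sum_abs _ _).trans ?_
    have hterm : ∀ α : Fin k ↪ Fin n, |∏ s, labeledInjDensity (F s) ℓ H α - c α|
        ≤ Fintype.card R * ((p : ℝ) ^ 2 / n) := by
      intro α
      refine (abs_prod_sub_prod_le_sum _ _ _ (fun s => labeledInjDensity_mem (F s) ℓ H α)
        fun s => rootedHomDensity_mem (F s) ℓ H α).trans ?_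
      refine (Finset.sum_le_sum fun s _ =>
        abs_labeledInjDensity_sub_rootedHomDensity_le (F s) ℓ hpn hn H α).trans ?_
      simp
    refine (Finset.sum_le_sum fun α _ => hterm α).trans (le_of_eq ?_)
    rw [Finset.sum_const, Finset.card_univ, Fintype.card_embedding_eq, Fintype.card_fin,
      Fintype.card_fin, nsmul_eq_mul, mul_comm]
  rw [homDensity_glue G hF n]
  refine (abs_sub_le _ _ _).trans ((add_le_add h2 h1).trans (le_of_eq ?_))
  ring

end Compare

/-! ### Moments of the empirical and of the limit measures -/

theorem integral_empiricalMeasure {d p k n : ℕ} (F : Fin d → SimpleGraph (Fin p))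
    (ℓ : Fin k ↪ Fin p) (G : SimpleGraph (Fin n)) (g : (Fin d → I) → ℝ) :
    ∫ x, g x ∂(empiricalMeasure F ℓ G)
      = (∑ α : Fin k ↪ Fin n, g (densityVec F ℓ G α)) / n.descFactorial k := by
  rw [empiricalMeasure, integral_smul_measure, integral_finsetSum_measure]
  · simp only [integral_dirac]
    rw [ENNReal.toReal_inv, ENNReal.toReal_natCast, smul_eq_mul, inv_mul_eq_div]
  · intro α _
    exact integrable_dirac (by simp)

/-- The condition `g 0 = 0` removes the atom at the origin; every nonconstant monomial satisfies it.
-/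
theorem integral_limitMeasure {d p k : ℕ} [NeZero d] (W : Graphon)
    (F : Fin d → SimpleGraph (Fin p)) (ℓ : Fin k ↪ Fin p) (g : C(Fin d → I, ℝ)) (hg : g 0 = 0) :
    ∫ x, g x ∂(limitMeasure W F ℓ)
      = ∫ x : Fin k → I, tHat W (F 0) ℓ x * g (tTildeVec W F ℓ x) := by
  have hprob := isProbabilityMeasure_limitMeasure W F ℓ
  have hint : Integrable g (limitMeasure W F ℓ) :=
    (BoundedContinuousFunction.mkOfCompact g).integrable _
  rw [limitMeasure] at hint ⊢
  rw [integral_add_measure hint.left_of_add_measure hint.right_of_add_measure,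
    integral_smul_measure, integral_dirac, hg, smul_zero, add_zero,
    integral_map (measurable_tTildeVec W F ℓ).aemeasurable
      g.continuous.measurable.aestronglyMeasurable,
    integral_withDensity_eq_integral_toReal_smul (measurable_tHat W (F 0) ℓ).ennreal_ofReal
      (Eventually.of_forall fun _ => ENNReal.ofReal_lt_top)]
  refine integral_congr_ae (Eventually.of_forall fun x => ?_)
  simp only [ENNReal.toReal_ofReal (tHat_mem W (F 0) ℓ x).1, smul_eq_mul]

/-- Probability measures on a cube converge weakly as soon as their moments do. -/
theorem tendsto_of_tendsto_moments {d : ℕ} {μs : ℕ → ProbabilityMeasure (Fin d → I)}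
    {μ : ProbabilityMeasure (Fin d → I)}
    (h : ∀ L : List (Fin d), Tendsto (fun n => ∫ x, (L.map fun m => (x m : ℝ)).prod ∂(μs n).toMeasure)
      atTop (𝓝 (∫ x, (L.map fun m => (x m : ℝ)).prod ∂μ.toMeasure))) :
    Tendsto μs atTop (𝓝 μ) := by
  let c : Fin d → C(Fin d → I, ℝ) := fun m => ⟨fun x => (x m : ℝ), by fun_prop⟩
  have hint : ∀ (ν : ProbabilityMeasure (Fin d → I)) (f : C(Fin d → I, ℝ)),
      Integrable f (ν : Measure (Fin d → I)) := fun ν f =>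
    (BoundedContinuousFunction.mkOfCompact f).integrable _
  have hev : ∀ (L : List (Fin d)) x, (L.map c).prod x = (L.map fun m => (x m : ℝ)).prod := by
    intro L x
    induction L with
    | nil => rfl
    | cons a L ih => simp only [List.map_cons, List.prod_cons, ContinuousMap.mul_apply, ih]; rfl
  -- The algebra generated by the coordinates is the linear span of monomials, so linearity of the
  -- integral suffices.
  have hA : ∀ f ∈ Algebra.adjoin ℝ (Set.range c), Tendsto (fun n => ∫ x, f x ∂(μs n).toMeasure)
      atTop (𝓝 (∫ x, f x ∂μ.toMeasure)) := by
    intro f hf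
    rw [← Subalgebra.mem_toSubmodule, Algebra.adjoin_eq_span] at hf
    induction hf using Submodule.span_induction with
    | mem f hf =>
      obtain ⟨L, hL, rfl⟩ := Submonoid.exists_list_of_mem_closure hf
      obtain ⟨L, rfl⟩ : L ∈ Set.range (List.map c) := (Set.range_list_map c).symm ▸ hL
      simpa only [hev] using h L
    | zero => simp
    | add f g _ _ hf hg =>
      simp only [ContinuousMap.add_apply, integral_add (hint _ f) (hint _ g)]
      exact hf.add hg
    | smul a f _ hf =>
      simp only [ContinuousMap.smul_apply, integral_smul]
      exact hf.const_smul a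
  have hsep : (Algebra.adjoin ℝ (Set.range c)).SeparatesPoints := by
    intro x y hxy
    obtain ⟨m, hm⟩ := Function.ne_iff.1 hxy
    exact ⟨c m, ⟨c m, Algebra.subset_adjoin ⟨m, rfl⟩, rfl⟩, fun h => hm (Subtype.ext h)⟩
  rw [ProbabilityMeasure.tendsto_iff_forall_integral_tendsto]
  intro f
  rw [Metric.tendsto_atTop]
  intro ε hε
  have hmem : f.toContinuousMap ∈ closure (Algebra.adjoin ℝ (Set.range c) : Set C(Fin d → I, ℝ)) := by
    rw [← Subalgebra.topologicalClosure_coe,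
      ContinuousMap.subalgebra_topologicalClosure_eq_top_of_separatesPoints _ hsep]
    trivial
  obtain ⟨g, hg, hfg⟩ := Metric.mem_closure_iff.1 hmem (ε / 3) (by positivity)
  obtain ⟨N, hN⟩ := Metric.tendsto_atTop.1 (hA g hg) (ε / 3) (by positivity)
  have hclose : ∀ ν : ProbabilityMeasure (Fin d → I),
      |∫ x, f x ∂ν.toMeasure - ∫ x, g x ∂ν.toMeasure| ≤ ε / 3 := by
    intro ν
    rw [← integral_sub (f.integrable _) (hint ν g), ← Real.norm_eq_abs]
    refine (norm_integral_le_of_norm_le_const (Eventually.of_forall fun x => ?_)).trans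
      (le_of_eq (by rw [probReal_univ, mul_one]))
    have := (ContinuousMap.dist_apply_le_dist (f := f.toContinuousMap) (g := g) x).trans hfg.le
    exact this
  refine ⟨N, fun n hn => ?_⟩
  have h1 := abs_le.1 (hclose (μs n))
  have h2 := abs_le.1 (hclose μ)
  have h3 := abs_lt.1 (hN n hn)
  rw [Real.dist_eq, abs_lt]
  constructor <;> linarith [h1.1, h1.2, h2.1, h2.2, h3.1, h3.2]

theorem IsWRandomGraph.ae_tendsto_Gamma_n {Ω : Type*} [MeasurableSpace Ω] {P : Measure Ω}
    [IsProbabilityMeasure P] {W : Graphon} {X : ℕ → Ω → I} {G : Ω → SimpleGraph ℕ}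
    (hG : IsWRandomGraph W P X G) {d p k : ℕ} [NeZero d] (F : Fin d → SimpleGraph (Fin p))
    (ℓ : Fin k ↪ Fin p) (hF : SameLabeledSubgraph F ℓ) :
    ∀ᵐ ω ∂P, Tendsto
      (fun n : ℕ => Gamma_n (Nat.le_add_left p n) F ℓ (restrictGraph (G ω) (n + p)))
      atTop (𝓝 (Gamma W F ℓ)) := by
  classical
  have hall : ∀ᵐ ω ∂P, ∀ L : List (Fin d),
      Tendsto (homDensity (glueFst (F 0) (fun s => F (L.get s)) ℓ)
          (glueSnd (F 0) (fun s => F (L.get s)) ℓ) (G ω)) atTop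
        (𝓝 (∫ x : Fin k → I, tHat W (F 0) ℓ x * ∏ s, tTilde W (F (L.get s)) ℓ x)) := by
    rw [ae_all_iff]
    intro L
    rw [← graphonDensity_glue]
    exact hG.ae_tendsto_homDensity (glueFst_ne_glueSnd _ _ _) (glue_edges_injective _ _ _)
  filter_upwards [hall] with ω hω
  refine tendsto_of_tendsto_moments fun L => ?_
  -- The empty moment is the total mass `1` on both sides. It is treated apart because gluing needs
  -- a copy and the empty monomial does not vanish at `0`.
  rcases eq_or_ne L [] with rfl | hL
  · simp
  have hne : Nonempty (Fin L.length) := ⟨⟨0, List.length_pos_iff.2 hL⟩⟩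
  have hprod : ∀ x : Fin d → I, (L.map fun m => (x m : ℝ)).prod = ∏ s, (x (L.get s) : ℝ) :=
    fun x => (Fin.prod_univ_fun_getElem L fun m => (x m : ℝ)).symm
  simp only [hprod]
  have hlim : ∫ x, ∏ s, (x (L.get s) : ℝ) ∂(Gamma W F ℓ).toMeasure
      = ∫ x : Fin k → I, tHat W (F 0) ℓ x * ∏ s, tTilde W (F (L.get s)) ℓ x :=
    integral_limitMeasure W F ℓ ⟨fun x => ∏ s, (x (L.get s) : ℝ), by fun_prop⟩
      (Finset.prod_eq_zero (Finset.mem_univ hne.some) (by simp))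
  rw [hlim]
  have hmom : ∀ n, ∫ x, ∏ s, (x (L.get s) : ℝ)
        ∂(Gamma_n (Nat.le_add_left p n) F ℓ (restrictGraph (G ω) (n + p))).toMeasure
      = (∑ α : Fin k ↪ Fin (n + p), ∏ s, labeledInjDensity (F (L.get s)) ℓ
          (restrictGraph (G ω) (n + p)) α) / (n + p).descFactorial k :=
    fun n => integral_empiricalMeasure F ℓ _ _
  simp only [hmom]
  have hshift : Tendsto (fun n : ℕ => n + p) atTop atTop := tendsto_add_atTop_nat p
  have hdiff : Tendsto (fun n : ℕ => ((Fintype.card (Fin L.length) * (p : ℝ) ^ 2 + (k : ℝ) ^ 2))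
      / ((n + p : ℕ) : ℝ)) atTop (𝓝 0) :=
    (tendsto_const_div_atTop_nhds_zero_nat _).comp hshift
  have hzero := squeeze_zero_norm' (f := fun n : ℕ => (∑ α : Fin k ↪ Fin (n + p),
      ∏ s, labeledInjDensity (F (L.get s)) ℓ (restrictGraph (G ω) (n + p)) α)
        / (n + p).descFactorial k
      - homDensity (glueFst (F 0) (fun s => F (L.get s)) ℓ)
          (glueSnd (F 0) (fun s => F (L.get s)) ℓ) (G ω) (n + p))
    ((eventually_gt_atTop 0).mono fun n hn =>
      abs_average_prod_labeledInjDensity_sub_homDensity_le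
        (fun s i j => hF (L.get s) 0 i j) (G ω) (Nat.le_add_left p n) (by omega)) hdiff
  simpa using hzero.add ((hω L).comp hshift)

/-! ### Degrees -/

/-- The vertex `0` of `[2]` as a word with a single character. -/
def edgeLabel : Fin 1 ↪ Fin 2 := ⟨fun _ => 0, fun _ _ _ => Subsingleton.elim _ _⟩

theorem notMem_range_edgeLabel : (1 : Fin 2) ∉ Set.range edgeLabel := by
  rintro ⟨_, h⟩
  exact absurd h (by decide : (0 : Fin 2) ≠ 1)

theorem labeledInjDensity_edge {n : ℕ} (hn : 2 ≤ n) (G : SimpleGraph (Fin n))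
    (α : Fin 1 ↪ Fin n) : labeledInjDensity ⊤ edgeLabel G α = normalizedDegree G (α 0) := by
  have hcard : (labeledInj ⊤ edgeLabel G α).ncard = (G.neighborSet (α 0)).ncard := by
    refine Set.ncard_congr (fun f _ => f 1) ?_ ?_ ?_
    · rintro f ⟨hf, hfα⟩
      have := hf 0 1 (by simp)
      rwa [← hfα 0]
    · rintro f g ⟨-, hf⟩ ⟨-, hg⟩ h
      ext i
      fin_cases i
      · exact congrArg Fin.val ((hf 0).trans (hg 0).symm)
      · exact congrArg Fin.val h
    · intro j hj
      have hne : α 0 ≠ j := G.ne_of_adj hj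
      refine ⟨⟨![α 0, j], ?_⟩, ⟨?_, ?_⟩, rfl⟩
      · intro a b h
        fin_cases a <;> fin_cases b <;> simp_all
      · intro a b hab
        fin_cases a <;> fin_cases b
        · simp at hab
        · exact hj
        · exact SimpleGraph.Adj.symm hj
        · simp at hab
      · intro i
        rw [Subsingleton.elim i 0]
        rfl
  rw [labeledInjDensity, normalizedDegree, hcard, Nat.descFactorial_one, Nat.cast_sub (by omega),
    Nat.cast_one]

theorem tTilde_edge (W : Graphon) {F : SimpleGraph (Fin 2)} (hF : F.Adj 0 1) (x : Fin 1 → I) :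
    tTilde W F edgeLabel x = degreeFun W (x 0) := by
  classical
  have hz : ∀ z : Fin 2 → I, zTilde W F edgeLabel (Function.extend edgeLabel x z)
      = W (x 0) (z 1) := by
    intro z
    have h0 : Function.extend edgeLabel x z 0 = x 0 := edgeLabel.injective.extend_apply x z 0
    have h1 : Function.extend edgeLabel x z 1 = z 1 :=
      Function.extend_apply' _ _ _ notMem_range_edgeLabel
    rw [zTilde, Finset.prod_eq_single (0, 1), h0, h1]
    · rintro ⟨a, b⟩ he hne
      fin_cases a <;> fin_cases b <;> simp_all
    · intro h
      refine absurd ?_ h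
      rw [Finset.mem_filter]
      exact ⟨Finset.mem_univ _, by decide, hF, fun h => notMem_range_edgeLabel h.2⟩
  have hmp := measurePreserving_eval (fun _ : Fin 2 => (volume : Measure I)) 1
  have hW : Measurable fun y => W (x 0) y := W.measurable'.comp measurable_prodMk_left
  simp only [tTilde, hz]
  rw [degreeFun, ← hmp.map_eq, integral_map hmp.measurable.aemeasurable hW.aestronglyMeasurable]
  rfl

theorem tHat_of_one {p : ℕ} (W : Graphon) (F : SimpleGraph (Fin p)) (ℓ : Fin 1 ↪ Fin p)
    (x : Fin 1 → I) : tHat W F ℓ x = 1 := by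
  classical
  rw [tHat]
  refine Finset.prod_eq_one fun e he => ?_
  exact absurd (Finset.mem_filter.1 he).2.1 (by simp [Subsingleton.elim e.1 e.2])

theorem measurable_degreeFun (W : Graphon) : Measurable (degreeFun W) :=
  (StronglyMeasurable.integral_prod_right' (ν := (volume : Measure I))
    W.measurable'.stronglyMeasurable).measurable

theorem limitMeasure_edge_apply (W : Graphon) {s : Set ℝ} (hs : MeasurableSet s) :
    limitMeasure W (fun _ : Fin 1 => ⊤) edgeLabel {x | (x 0 : ℝ) ∈ s}
      = volume {y : I | degreeFun W y ∈ s} := by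
  have hm : MeasurableSet {x : Fin 1 → I | (x 0 : ℝ) ∈ s} :=
    (measurable_subtype_coe.comp (measurable_pi_apply 0)) hs
  have hmp := measurePreserving_eval (fun _ : Fin 1 => (volume : Measure I)) 0
  have hpre : tTildeVec W (fun _ : Fin 1 => ⊤) edgeLabel ⁻¹' {x | (x 0 : ℝ) ∈ s}
      = Function.eval 0 ⁻¹' {y : I | degreeFun W y ∈ s} := by
    ext x
    simp [tTildeVec, tTilde_edge W (F := ⊤) (by simp)]
  simp only [limitMeasure, tHat_of_one, ENNReal.ofReal_one, integral_const, probReal_univ,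
    smul_eq_mul, mul_one, sub_self, ENNReal.ofReal_zero, zero_smul, add_zero]
  rw [show (fun _ : Fin 1 → I => (1 : ℝ≥0∞)) = 1 from rfl, withDensity_one,
    Measure.map_apply (measurable_tTildeVec _ _ _) hm, hpre,
    ← hmp.measure_preimage (s := {y : I | degreeFun W y ∈ s})
      (measurable_degreeFun W hs).nullMeasurableSet]
  rfl

theorem empiricalMeasure_edge_apply {n : ℕ} (hn : 2 ≤ n) (W : Graphon) (G : SimpleGraph (Fin n))
    (y : I) :
    (empiricalMeasure (fun _ : Fin 1 => ⊤) edgeLabel G).real {x | (x 0 : ℝ) ≤ degreeFun W y}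
      = degreeCDF W G y := by
  classical
  have hm : MeasurableSet {x : Fin 1 → I | (x 0 : ℝ) ≤ degreeFun W y} :=
    measurableSet_le (by fun_prop) measurable_const
  rw [← integral_indicator_one hm, integral_empiricalMeasure, Nat.descFactorial_one, degreeCDF,
    ← (Equiv.uniqueEmbeddingEquivResult (α := Fin 1) (β := Fin n)).sum_comp]
  congr 1
  refine Finset.sum_congr rfl fun α _ => ?_
  simp only [Set.indicator, Set.mem_ofPred_eq, densityVec, labeledInjDensity_edge hn, Pi.one_apply]
  rfl

/-- Pointwise convergence of nondecreasing functions to the identity of `[0,1]` is uniform. -/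
theorem tendstoUniformly_of_monotone_of_tendsto_id {u : ℕ → I → ℝ} (hu : ∀ n, Monotone (u n))
    (h : ∀ y, Tendsto (fun n => u n y) atTop (𝓝 (y : ℝ))) :
    TendstoUniformly u (fun y : I => (y : ℝ)) atTop := by
  rw [Metric.tendstoUniformly_iff]
  intro ε hε
  obtain ⟨N, hN⟩ := exists_nat_one_div_lt (half_pos hε)
  have hM : (0 : ℝ) < (N : ℝ) + 1 := by positivity
  -- A grid of mesh `1 / (N + 1) < ε / 2` that includes both endpoints. Convergence at its finitely
  -- many points controls each `y` through its two grid neighbours.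
  let g : Fin (N + 2) → I := fun j => ⟨(j : ℝ) / ((N : ℝ) + 1), by positivity, by
    rw [div_le_one hM]
    exact_mod_cast Nat.lt_succ_iff.1 j.2⟩
  have hev : ∀ᶠ n in atTop, ∀ j, |u n (g j) - g j| < ε / 2 :=
    eventually_all.2 fun j => Metric.tendsto_nhds.1 (h (g j)) _ (half_pos hε)
  filter_upwards [hev] with n hn y
  have hy0 : (0 : ℝ) ≤ y * ((N : ℝ) + 1) := mul_nonneg y.2.1 hM.le
  have hy1 : (y : ℝ) * ((N : ℝ) + 1) ≤ ((N + 1 : ℕ) : ℝ) := by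
    push_cast
    exact mul_le_of_le_one_left hM.le y.2.2
  have hc : ⌈(y : ℝ) * ((N : ℝ) + 1)⌉₊ < N + 2 := Nat.lt_succ_iff.2 (Nat.ceil_le.2 hy1)
  have hf : ⌊(y : ℝ) * ((N : ℝ) + 1)⌋₊ < N + 2 := (Nat.floor_le_ceil _).trans_lt hc
  have hup : y ≤ g ⟨_, hc⟩ := Subtype.coe_le_coe.1 ((le_div_iff₀ hM).2 (Nat.le_ceil _))
  have hlo : g ⟨_, hf⟩ ≤ y := Subtype.coe_le_coe.1 ((div_le_iff₀ hM).2 (Nat.floor_le hy0))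
  have hup' : (g ⟨_, hc⟩ : ℝ) < y + 1 / ((N : ℝ) + 1) := by
    have := Nat.ceil_lt_add_one hy0
    change (_ / _ : ℝ) < _
    rw [div_lt_iff₀ hM, add_mul, one_div_mul_cancel hM.ne']
    exact this
  have hlo' : (y : ℝ) - 1 / ((N : ℝ) + 1) < g ⟨_, hf⟩ := by
    have := Nat.lt_floor_add_one ((y : ℝ) * ((N : ℝ) + 1))
    change _ < (_ / _ : ℝ)
    rw [lt_div_iff₀ hM, sub_mul, one_div_mul_cancel hM.ne']
    linarith
  have h1 := abs_lt.1 (hn ⟨_, hc⟩)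
  have h2 := abs_lt.1 (hn ⟨_, hf⟩)
  have h3 := hu n hup
  have h4 := hu n hlo
  rw [Real.dist_eq, abs_lt]
  constructor <;> linarith [h1.1, h1.2, h2.1, h2.2]

/-! ### Uniform convergence of the degree distribution functions -/

theorem degreeCDF_monotone {W : Graphon} (hD : Monotone (degreeFun W)) {n : ℕ}
    (G : SimpleGraph (Fin n)) : Monotone (degreeCDF W G) := by
  classical
  intro x y hxy
  rw [degreeCDF, degreeCDF]
  gcongr with i
  split_ifs with h1 h2
  · exact le_rfl
  · exact absurd (h1.trans (hD hxy)) h2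
  · exact zero_le_one
  · exact le_rfl

theorem IsWRandomGraph.ae_tendstoUniformly_degreeCDF {Ω : Type*} [MeasurableSpace Ω]
    {P : Measure Ω} [IsProbabilityMeasure P] {W : Graphon} {X : ℕ → Ω → I} {G : Ω → SimpleGraph ℕ}
    (hG : IsWRandomGraph W P X G) (hD : StrictMono (degreeFun W)) :
    ∀ᵐ ω ∂P, TendstoUniformly
      (fun (n : ℕ) (y : I) => degreeCDF W (restrictGraph (G ω) n) y)
      (fun y : I => (y : ℝ)) atTop := by
  filter_upwards [hG.ae_tendsto_Gamma_n (fun _ : Fin 1 => ⊤) edgeLabel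
    fun _ _ _ _ => Iff.rfl] with ω hω
  refine tendstoUniformly_of_monotone_of_tendsto_id
    (fun n => degreeCDF_monotone hD.monotone _) fun y => ?_
  set E : Set (Fin 1 → I) := {x | (x 0 : ℝ) ≤ degreeFun W y} with hE
  -- The frontier lies in `{x | x 0 = D(y)}`, whose mass is the Lebesgue measure of the level set of
  -- `D` at `D(y)`. Injectivity of `D` reduces this set to the point `y`.
  have hfrontier : limitMeasure W (fun _ : Fin 1 => ⊤) edgeLabel (frontier E) = 0 := by
    refine measure_mono_null (frontier_le_subset_eq (by fun_prop) continuous_const) ?_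
    have hset : {y' : I | degreeFun W y' ∈ ({degreeFun W y} : Set ℝ)} = {y} := by
      ext y'
      simp [hD.injective.eq_iff]
    have := limitMeasure_edge_apply W (measurableSet_singleton (degreeFun W y))
    rw [hset, measure_singleton] at this
    exact this
  have hval : (limitMeasure W (fun _ : Fin 1 => ⊤) edgeLabel).real E = y := by
    have hset : {y' : I | degreeFun W y' ∈ Set.Iic (degreeFun W y)} = Set.Iic y := by
      ext y'
      simp [hD.le_iff_le]
    have := limitMeasure_edge_apply W (measurableSet_Iic (a := degreeFun W y))
    rw [hset, unitInterval.volume_Iic] at this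
    change (limitMeasure W (fun _ : Fin 1 => ⊤) edgeLabel {x | (x 0 : ℝ) ∈ Set.Iic _}).toReal = y
    rw [this, ENNReal.toReal_ofReal y.2.1]
  have hconv := ProbabilityMeasure.tendsto_measure_of_null_frontier_of_tendsto hω (E := E)
    (by
      rw [ProbabilityMeasure.null_iff_toMeasure_null]
      exact hfrontier)
  have hreal := (NNReal.continuous_coe.tendsto _).comp hconv
  -- The weak convergence is indexed by `n + p` with `p = 2` for the edge.
  rw [← tendsto_add_atTop_iff_nat 2]
  have hlim : ((Gamma W (fun _ : Fin 1 => ⊤) edgeLabel E : NNReal) : ℝ) = y := hval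
  rw [hlim] at hreal
  refine hreal.congr fun n => ?_
  exact empiricalMeasure_edge_apply (by omega) W (restrictGraph (G ω) (n + 2)) y

end GraphonLLN

/-- The first part is the almost sure weak convergence of `Γ_n^{F,ℓ}` to `Γ^{F,ℓ}` (the sequence
starts at `n = p`, the first index for which the densities are defined); the second part is the
almost sure uniform convergence of the empirical CDF of the degrees. -/
theorem theorem3p1 {Ω : Type*} [MeasurableSpace Ω] (P : Measure Ω) [IsProbabilityMeasure P]
    (W : Graphon) (X : ℕ → Ω → I) (G : Ω → SimpleGraph ℕ) (hG : IsWRandomGraph W P X G) :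
    (∀ (d p k : ℕ) [NeZero d] (_hk : 1 ≤ k) (F : Fin d → SimpleGraph (Fin p)) (ℓ : Fin k ↪ Fin p),
      SameLabeledSubgraph F ℓ →
      ∀ᵐ ω ∂P, Tendsto
        (fun n : ℕ => Gamma_n (Nat.le_add_left p n) F ℓ (restrictGraph (G ω) (n + p)))
        atTop (𝓝 (Gamma W F ℓ))) ∧
    (StrictMono (degreeFun W) →
      ∀ᵐ ω ∂P, TendstoUniformly
        (fun (n : ℕ) (y : I) => degreeCDF W (restrictGraph (G ω) n) y)
        (fun y : I => (y : ℝ)) atTop) := by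
  exact ⟨fun _ _ _ _ _ F ℓ hF => hG.ae_tendsto_Gamma_n F ℓ hF,
    hG.ae_tendstoUniformly_degreeCDF⟩
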